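/- A \emph{pair of algebraically closed fields} $(K,k)$ consists of an algebraically closed field $K$ and a proper algebraically closed subfield $k$ of $K$; it is a structure for the language $L_U$ of rings augmented by a unary relation symbol $U$ interpreted as $k$. Let $2\mathrm{ACF}$ be a set of $L_U$-sentences whose models are these pairs. For $m,n\in\mathbb N$ and $P\in\mathbb Z[X_1,\dots,X_m,Y_1,\dots,Y_n,Z]$ let $\phi_P(y,z)$, $y=(y_1,\dots,y_n)$, be the $L_U$-formula $$\exists x_1\cdots\exists x_m\big(U(x_1)\wedge\cdots\wedge U(x_m)\wedge P(x,y,z)=0\wedge P(x,y,Z)\neq 0\big),$$ where $P(x,y,Z)\ne 0$ says that some coefficient of this polynomial in $Z$ is nonzero, and let $\Phi_2$ be the family of all $\phi_P(y,z)$. For a pair $(K,k)$ and $A\subseteq K$ let $$\Phi_2(A)=\{b\in K:\ (K,k)\models\phi_P(a,b)\text{ for some } m,n,P \text{ and some } a\in A^n\};$$ a $\Phi_2$-set in $(K,k)$ is a set $\phi_P(a,K)$ with $a\in K^n$. For a nonempty set $S\subseteq K^n$ put $$\dim_2 S=\max\{\operatorname{rk}(K\cup\{s_1,\dots,s_n\}\,|\,K):\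 s\in S^*\},$$ where $(K^*,k^*,S^*)$ is a $\kappa$-saturated elementary extension of $(K,k,S)$ with $\kappa>|K|$ (the value does not depend on its choice), and $\operatorname{rk}(B|A)$ is the size of any basis of $\Phi_2(B)$ over $\Phi_2(A)$ in $K^*$; put $\dim_2\emptyset=-\infty$. Definable means definable with parameters. For $S\subseteq K^{n+1}$ and $a\in K^n$ let $S(a)=\{b\in K:(a,b)\in S\}$. \textbf{Proposition.} For every pair $(K,k)$ and every $A\subseteq K$, $\Phi_2(A)$ is the algebraic closure of $k(A)$ in $K$, and $A\mapsto\Phi_2(A)$ is a pregeometry on $K$. Moreover, $(\Phi_2,2\mathrm{ACF})$ is bounded, that is: (1) for no pair $(K,k)$ is $K$ a finite union of $\Phi_2$-sets in $(K,k)$; (2) for every pair $(K,k)$, every $n\in\mathbb N$ and every definable $S\subseteq K^{n+1}$, the set $\{a\in K^n:\ \dim_2 S(a)=0\}$ is definable in $(K,k)$. The definition in (2) is uniform: for every $n$ and every $L_U$-formula $\psi(y_1,\dots,y_n,z)$ there is an $L_U$-formula $\theta(y_1,\dots,y_n)$ such that for every pair $(K,k)$ and every $a\in K^n$, $$(K,k)\models\theta(a)\iff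 \dim_2\psi(a,K)=0 .$$ -/

import Mathlib

open FirstOrder

universe u

set_option linter.style.haveILetI false

namespace PairACF

open FirstOrder.Language Cardinal

noncomputable section

/-! ### Expanding a language and a structure by a predicate -/

/-- The only relation symbol of a language consisting of a single `n`-ary relation symbol. -/
inductive RelSymb (n : ℕ) : ℕ → Type
  | name : RelSymb n n

/-- The language consisting of a single `n`-ary relation symbol. -/
def relLang (n : ℕ) : FirstOrder.Language.{0, 0} := ⟨fun _ => Empty, RelSymb n⟩

/-- The language `L` augmented by a new `n`-ary relation symbol. -/
abbrev addRel (L : FirstOrder.Language.{0, 0}) (n : ℕ) : FirstOrder.Language.{0, 0} := L.sum (relLang n)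

/-- The new `n`-ary relation symbol. -/
def newRel (L : FirstOrder.Language.{0, 0}) (n : ℕ) : (addRel L n).Relations n := Sum.inr RelSymb.name

/-- A set `S ⊆ M ^ n` as a structure for the language with one `n`-ary relation symbol. -/
@[reducible]
def relStructure {M : Type u} {n : ℕ} (S : Set (Fin n → M)) : (relLang n).Structure M where
  funMap f := nomatch f
  RelMap r := match r with
    | RelSymb.name => fun x => x ∈ S

/-- The expansion `(M, S)` of the `L`-structure `M` by the set `S ⊆ M ^ n`. -/
@[reducible]
def expand (L : FirstOrder.Language.{0, 0}) {M : Type u} [L.Structure M] {n : ℕ} (S : Set (Fin n → M)) :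
    (addRel L n).Structure M :=
  letI := relStructure S
  FirstOrder.Language.sumStructure L (relLang n) M

/-! ### Saturation -/

/-- `N` is `κ`-saturated: every set of formulas in one variable, with parameters from a set `A` of
size less than `κ`, that is finitely satisfiable in `N` is realized in `N`. -/
def IsSaturated (L : FirstOrder.Language.{0, 0}) (N : Type u) [L.Structure N] (κ : Cardinal.{u}) : Prop :=
  ∀ A : Set N, #A < κ → ∀ p : Set (L[[A]].Formula (Fin 1)),
    (∀ F : Finset (L[[A]].Formula (Fin 1)), ↑F ⊆ p →
      ∃ b : N, ∀ φ ∈ F, φ.Realize (fun _ => b)) →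
    ∃ b : N, ∀ φ ∈ p, φ.Realize (fun _ => b)

/-- A `κ`-saturated elementary extension `(N, T)` of `(M, S)`, where `κ` is infinite and
`κ > |M|`. -/
structure SaturatedExtension (L : FirstOrder.Language.{0, 0}) {M : Type u} [L.Structure M] {n : ℕ}
    (S : Set (Fin n → M)) where
  /-- the underlying set of the extension -/
  N : Type u
  [str : L.Structure N]
  /-- the interpretation of the name for `S` in the extension -/
  T : Set (Fin n → N)
  emb : @ElementaryEmbedding (addRel L n) M N (expand L S) (expand L T)
  κ : Cardinal.{u}
  aleph0_le : ℵ₀ ≤ κ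
  card_lt : #M < κ
  saturated : letI := expand L T; IsSaturated (addRel L n) N κ

/-- The embedding `M → M*` underlying an elementary extension `(M*, S*)` of `(M, S)`. -/
def SaturatedExtension.ι {L : FirstOrder.Language.{0, 0}} {M : Type u} [L.Structure M] {n : ℕ}
    {S : Set (Fin n → M)} (E : SaturatedExtension L S) : M → E.N :=
  letI := E.str
  letI := expand L S
  letI := expand L E.T
  E.emb.toFun

/-! ### Pregeometries given by families of formulas -/

/-- `cl` is a pregeometry on the set `M`. -/
structure IsPregeometry {M : Type u} (cl : Set M → Set M) : Prop where
  subset_cl : ∀ A, A ⊆ cl A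
  mono : ∀ A B, A ⊆ B → cl A ⊆ cl B
  cl_cl : ∀ A, cl (cl A) = cl A
  finitary : ∀ A, ∀ b ∈ cl A, ∃ F : Set M, F.Finite ∧ F ⊆ A ∧ b ∈ cl F
  exchange : ∀ A a b, b ∈ cl (insert a A) → b ∉ cl A → a ∈ cl (insert b A)

/-- A family `Φ = (φ_i(x_1, …, x_{m_i}, y))_{i ∈ I}` of `L`-formulas; the variable `y` is
`Sum.inr ()`. -/
structure FormulaFamily (L : FirstOrder.Language.{0, 0}) where
  /-- the index set `I` -/
  Idx : Type
  arity : Idx → ℕ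
  formula : (i : Idx) → L.Formula (Fin (arity i) ⊕ Unit)

namespace FormulaFamily

variable {L : FirstOrder.Language.{0, 0}} (Φ : FormulaFamily L) {M : Type u} [L.Structure M]

/-- The set `φ_i(a_1, …, a_{m_i}, M)`. -/
def fiber (i : Φ.Idx) (a : Fin (Φ.arity i) → M) : Set M :=
  {b | (Φ.formula i).Realize (Sum.elim a fun _ => b)}

/-- The `Φ`-image `Φ(A)` of a set `A ⊆ M`. -/
def image (A : Set M) : Set M :=
  {b | ∃ (i : Φ.Idx) (a : Fin (Φ.arity i) → M), (∀ j, a j ∈ A) ∧ b ∈ Φ.fiber i a}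

/-- `X` is a `Φ`-set in `M`. -/
def IsPhiSet (X : Set M) : Prop :=
  ∃ (i : Φ.Idx) (a : Fin (Φ.arity i) → M), X = Φ.fiber i a

/-- `I` is a basis of `Φ(B)` over `Φ(A)`, for the operation `A ↦ Φ(A)`: it is contained in `Φ(B)`,
independent over `A`, and together with `A` it generates `Φ(B)`. -/
def IsBasisOver (A B I : Set M) : Prop :=
  I ⊆ Φ.image B ∧ (∀ x ∈ I, x ∉ Φ.image (A ∪ (I \ {x}))) ∧ Φ.image B = Φ.image (A ∪ I)

/-- `rk(B|A)` for `A ⊆ B ⊆ M`: the size of any basis of `Φ(B)` over `Φ(A)`.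
(In a pregeometry bases exist and all have the same size.) -/
def rk (B A : Set M) : Cardinal.{u} :=
  sInf {c | ∃ I : Set M, Φ.IsBasisOver A B I ∧ c = #I}

open Classical in
/-- The dimension of `S ⊆ M ^ n`, with `⊥` for `-∞`: the maximum of `rk(M s | M)` over all `s ∈ S*`,
for a `κ`-saturated elementary extension `(M*, S*)` of `(M, S)` with `κ > |M|`. This maximum does
not depend on the extension, and the supremum is taken over all of them. -/
def dim {n : ℕ} (S : Set (Fin n → M)) : WithBot ℕ∞ :=
  if S = ∅ then ⊥ else
    ((⨆ (E : SaturatedExtension L S) (s : Fin n → E.N) (_ : s ∈ E.T),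
      letI := E.str
      Cardinal.toENat
        (Φ.rk (Set.range E.ι ∪ Set.range s) (Set.range E.ι)) : ℕ∞) : WithBot ℕ∞)

end FormulaFamily

/-- For `S ⊆ M ^ (n + 1)` and `a ∈ M ^ n`, the set `S(a) = {b ∈ M : (a, b) ∈ S}` (as a subset of
`M ^ 1`). -/
def section_ {M : Type u} {n : ℕ} (S : Set (Fin (n + 1) → M)) (a : Fin n → M) :
    Set (Fin 1 → M) :=
  {b | Fin.append a b ∈ S}

section General

variable {L : FirstOrder.Language.{0, 0}} (Φ : FormulaFamily L) (Γ : L.Theory)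

/-- `(Φ, Γ)` defines a pregeometry: in every model `M` of `Γ` the operation `A ↦ Φ(A)` is a
pregeometry on `M`. -/
def DefinesPregeometry : Prop :=
  ∀ (M : Type u) [L.Structure M] [Nonempty M], M ⊨ Γ →
    IsPregeometry (Φ.image : Set M → Set M)

/-- `(Φ, Γ)` is nontrivial: no model of `Γ` is a finite union of `Φ`-sets. -/
def IsNontrivial : Prop :=
  ∀ (M : Type u) [L.Structure M] [Nonempty M], M ⊨ Γ →
    ¬ ∃ F : Set (Set M), F.Finite ∧ (∀ X ∈ F, Φ.IsPhiSet X) ∧ ⋃₀ F = Set.univ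

/-- `(Φ, Γ)` is bounded: it is nontrivial and for every model `M` of `Γ` and every set
`S ⊆ M ^ (n + 1)` definable in `M` (with parameters), the set `{a ∈ M ^ n : dim S(a) = 0}` is
definable in `M` (with parameters). -/
def IsBounded : Prop :=
  IsNontrivial.{u} Φ Γ ∧
    ∀ (M : Type u) [L.Structure M] [Nonempty M], M ⊨ Γ →
      ∀ (n : ℕ) (S : Set (Fin (n + 1) → M)), (Set.univ : Set M).Definable L S →
        (Set.univ : Set M).Definable L {a : Fin n → M | Φ.dim (section_ S a) = 0}

end General

/-! ### Pairs of algebraically closed fields -/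

/-- The language `L_U` of rings augmented by a unary relation symbol `U`. -/
abbrev LU : FirstOrder.Language.{0, 0} := addRel FirstOrder.Language.ring 1

/-- The `L_U`-structure `(K, k)`, where `k` is a subfield of the field `K`. -/
@[reducible]
def pairStructure (K : Type u) [Field K] (k : Subfield K) : LU.Structure K :=
  letI := Ring.compatibleRingOfRing K
  expand FirstOrder.Language.ring {x : Fin 1 → K | x 0 ∈ k}

section Formulas

variable {α : Type}

/-- The `L_U`-term given by an integer polynomial. -/
def polyTerm (p : MvPolynomial α ℤ) : LU.Term α :=
  LHom.sumInl.onTerm (Ring.termOfFreeCommRing (MvPolynomial.aeval FreeCommRing.of p))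

/-- The formula `p = 0`. -/
def polyEqZero (p : MvPolynomial α ℤ) : LU.Formula α :=
  (polyTerm p).equal (polyTerm 0)

/-- The formula `U(p)`. -/
def polyMemU (p : MvPolynomial α ℤ) : LU.Formula α :=
  (newRel FirstOrder.Language.ring 1).formula ![polyTerm p]

/-- The universal closure of a formula. -/
def allClosure {n : ℕ} (φ : LU.Formula (Fin n)) : LU.Sentence :=
  Formula.iAlls (Fin n) (φ.relabel Sum.inr)

/-- The formula `U(x_1) ∧ … ∧ U(x_m)`. -/
def varsMemU {m : ℕ} (x : Fin m → α) : LU.Formula α :=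
  Formula.iInf fun j => polyMemU (MvPolynomial.X (x j))

end Formulas

open MvPolynomial in
/-- A set of `L_U`-sentences whose models are the pairs of algebraically closed fields `(K, k)`,
`k` a proper subfield of `K`: the axioms of algebraically closed fields for `K`; `U` is closed under
all integer polynomials and under inverses; every monic polynomial of positive degree over `U` has
a zero in `U`; not every element is in `U`. -/
def twoACF : LU.Theory :=
  LHom.sumInl.onTheory Theory.field ∪
  LHom.sumInl.onTheory (Field.genericMonicPolyHasRoot '' {n | 0 < n}) ∪
  {σ | ∃ (n : ℕ) (p : MvPolynomial (Fin n) ℤ),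
    σ = allClosure ((varsMemU id).imp (polyMemU p))} ∪
  {allClosure (n := 2)
    ((polyMemU (X 0)).imp ((polyEqZero (X 0 * X 1 - 1)).imp (polyMemU (X 1))))} ∪
  {σ | ∃ n : ℕ, 0 < n ∧ σ = allClosure (n := n) ((varsMemU id).imp
    (Formula.iExs (Fin 1) (polyMemU (X (Sum.inr 0)) ⊓
      polyEqZero (X (Sum.inr 0) ^ n + ∑ i : Fin n, X (Sum.inl i) * X (Sum.inr 0) ^ (i : ℕ)))))} ∪
  {(allClosure (n := 1) (polyMemU (X 0))).not}

/-! ### The family `Φ₂` -/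

open MvPolynomial in
/-- For `P(X, Y, Z) ∈ ℤ[X, Y, Z]`, `X = (X_1, …, X_m)`, `Y = (Y_1, …, Y_n)`, given as a polynomial
in `Z` over `ℤ[X, Y]`, the `L_U`-formula `φ_P(y, z)`:
`∃ x (U(x) ∧ P(x, y, z) = 0 ∧ P(x, y, Z) ≠ 0)`,
where `P(x, y, Z) ≠ 0` says that some coefficient of `P(x, y, Z)` is not zero. -/
def phi (m n : ℕ) (P : Polynomial (MvPolynomial (Fin m ⊕ Fin n) ℤ)) :
    LU.Formula (Fin n ⊕ Unit) :=
  let ρ : Fin m ⊕ Fin n → (Fin n ⊕ Unit) ⊕ Fin m := Sum.elim Sum.inr (Sum.inl ∘ Sum.inl)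
  Formula.iExs (Fin m)
    (varsMemU Sum.inr ⊓
      polyEqZero (P.eval₂ (rename ρ).toRingHom (X (Sum.inl (Sum.inr ())))) ⊓
      Formula.iSup fun i : Fin (P.natDegree + 1) => (polyEqZero (rename ρ (P.coeff i))).not)

/-- The family `Φ₂` of all formulas `φ_P(y, z)`. -/
def Phi2 : FormulaFamily LU where
  Idx := Σ m n : ℕ, Polynomial (MvPolynomial (Fin m ⊕ Fin n) ℤ)
  arity i := i.2.1
  formula i := phi i.1 i.2.1 i.2.2

/-! ### The axioms and formulas mean what they should -/

section
variable {K : Type u} [Field K] (k : Subfield K) {α : Type}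

theorem realize_polyTerm (p : MvPolynomial α ℤ) (v : α → K) :
    letI := pairStructure K k
    (polyTerm p).realize v = MvPolynomial.aeval v p := by
  letI := Ring.compatibleRingOfRing K
  letI := relStructure {x : Fin 1 → K | x 0 ∈ k}
  simp only [polyTerm]
  refine (LHom.realize_onTerm (M := K) (LHom.sumInl) _ v).trans ?_
  rw [Ring.realize_termOfFreeCommRing]
  have : (FreeCommRing.lift v).comp (MvPolynomial.aeval FreeCommRing.of : MvPolynomial α ℤ →ₐ[ℤ] FreeCommRing α).toRingHom
     = (MvPolynomial.aeval v : MvPolynomial α ℤ →ₐ[ℤ] K).toRingHom := by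
    apply MvPolynomial.ringHom_ext
    · intro r; simp
    · intro i; simp
  exact congrArg (fun f => f p) this

theorem realize_polyEqZero (p : MvPolynomial α ℤ) (v : α → K) :
    letI := pairStructure K k
    (polyEqZero p).Realize v ↔ MvPolynomial.aeval v p = 0 := by
  letI := pairStructure K k
  rw [polyEqZero, Formula.realize_equal, realize_polyTerm, realize_polyTerm]
  simp

theorem realize_polyMemU (p : MvPolynomial α ℤ) (v : α → K) :
    letI := pairStructure K k
    (polyMemU p).Realize v ↔ MvPolynomial.aeval v p ∈ k := by
  letI := pairStructure K k
  rw [polyMemU, Formula.realize_rel, ← realize_polyTerm k]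
  rfl

theorem realize_varsMemU {m : ℕ} (x : Fin m → α) (v : α → K) :
    letI := pairStructure K k
    (varsMemU x).Realize v ↔ ∀ j, v (x j) ∈ k := by
  letI := pairStructure K k
  simp [varsMemU, Formula.realize_iInf, realize_polyMemU]

theorem realize_allClosure {M : Type u} [LU.Structure M] {n : ℕ} (φ : LU.Formula (Fin n)) :
    M ⊨ allClosure φ ↔ ∀ v : Fin n → M, φ.Realize v := by
  simp only [allClosure, Sentence.Realize, Formula.realize_iAlls, Formula.realize_relabel]
  simp [Function.comp_def]

/-- The meaning of the formulas `φ_P(y, z)` in a pair. -/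
theorem mem_fiber_Phi2 (m n : ℕ) (P : Polynomial (MvPolynomial (Fin m ⊕ Fin n) ℤ))
    (a : Fin n → K) (b : K) :
    letI := pairStructure K k
    b ∈ Phi2.fiber ⟨m, n, P⟩ a ↔ ∃ x : Fin m → K, (∀ j, x j ∈ k) ∧
      (P.map (MvPolynomial.aeval (Sum.elim x a)).toRingHom).eval b = 0 ∧
      P.map (MvPolynomial.aeval (Sum.elim x a)).toRingHom ≠ 0 := by
  letI := pairStructure K k
  change (phi m n P).Realize (Sum.elim a fun _ => b : Fin n ⊕ Unit → K) ↔ _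
  rw [phi, Formula.realize_iExs]
  simp only [Formula.realize_inf, realize_varsMemU,
    realize_polyEqZero, Formula.realize_iSup, Formula.realize_not]
  refine exists_congr fun x => ?_
  rw [and_assoc]
  have hρ : (Sum.elim (Sum.elim a fun _ => b) x : (Fin n ⊕ Unit) ⊕ Fin m → K) ∘
      (Sum.elim Sum.inr (Sum.inl ∘ Sum.inl) : Fin m ⊕ Fin n → (Fin n ⊕ Unit) ⊕ Fin m) = Sum.elim x a := by
    ext i; rcases i with i | i <;> rfl
  refine and_congr ?_ (and_congr ?_ ?_)
  · simp
  · rw [Polynomial.eval_map, ← AlgHom.coe_toRingHom, Polynomial.hom_eval₂]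
    have : (MvPolynomial.aeval (Sum.elim (Sum.elim a fun _ => b) x : (Fin n ⊕ Unit) ⊕ Fin m → K)  : _ →ₐ[ℤ] K).toRingHom.comp
      (MvPolynomial.rename (Sum.elim Sum.inr (Sum.inl ∘ Sum.inl) : Fin m ⊕ Fin n → (Fin n ⊕ Unit) ⊕ Fin m)).toRingHom
       = (MvPolynomial.aeval (Sum.elim x a) : _ →ₐ[ℤ] K).toRingHom := by
      apply MvPolynomial.ringHom_ext
      · intro r; simp
      · intro i; simp [← hρ]
    erw [this]
    simp
  · rw [Ne, Polynomial.ext_iff, not_forall]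
    simp only [MvPolynomial.aeval_rename, hρ, Polynomial.coeff_map, Polynomial.coeff_zero]
    constructor
    · rintro ⟨i, hi⟩; exact ⟨i, hi⟩
    · rintro ⟨i, hi⟩
      refine ⟨⟨i, ?_⟩, hi⟩
      by_contra h
      apply hi
      rw [Polynomial.coeff_eq_zero_of_natDegree_lt (by omega)]; simp

/-- `(K, k)` is a model of `twoACF` iff it is a pair of algebraically closed fields. -/
theorem models_iff :
    letI := pairStructure K k
    K ⊨ twoACF ↔ IsAlgClosed K ∧ IsAlgClosed k ∧ k ≠ ⊤ := by
  letI := Ring.compatibleRingOfRing K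
  letI := relStructure {x : Fin 1 → K | x 0 ∈ k}
  letI := pairStructure K k
  have h1 : K ⊨ (LHom.sumInl : FirstOrder.Language.ring →ᴸ LU).onTheory Theory.field :=
    (LHom.onTheory_model (M := K) LHom.sumInl _).2 inferInstance
  have h2 : K ⊨ (LHom.sumInl : FirstOrder.Language.ring →ᴸ LU).onTheory (Field.genericMonicPolyHasRoot '' {n | 0 < n}) ↔ IsAlgClosed K := by
    refine (LHom.onTheory_model (M := K) LHom.sumInl _).trans ?_
    constructor
    · intro h
      simp only [Theory.model_iff, Set.mem_image, forall_exists_index, and_imp] at h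
      refine IsAlgClosed.of_exists_root _ ?_
      intro p hpm hpi
      have := h _ p.natDegree (Polynomial.natDegree_pos_iff_degree_pos.2
        (Polynomial.degree_pos_of_irreducible hpi)) rfl
      rw [Field.realize_genericMonicPolyHasRoot] at this
      exact this ⟨_, hpm, rfl⟩
    · intro h
      simp only [Theory.model_iff, Set.mem_image, forall_exists_index, and_imp]
      rintro _ n hn0 rfl
      simp only [Field.realize_genericMonicPolyHasRoot]
      rintro ⟨p, _, rfl⟩
      exact IsAlgClosed.exists_root p (ne_of_gt (Polynomial.natDegree_pos_iff_degree_pos.1 hn0))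
  simp only [twoACF, Theory.model_union_iff, h1, h2, true_and]
  have h3 : K ⊨ ({σ | ∃ (n : ℕ) (p : MvPolynomial (Fin n) ℤ),
    σ = allClosure ((varsMemU id).imp (polyMemU p))} : LU.Theory) := by
    rw [Theory.model_iff]
    rintro _ ⟨n, p, rfl⟩
    rw [realize_allClosure]
    intro v
    rw [Formula.realize_imp, realize_varsMemU, realize_polyMemU]
    intro hv
    have : MvPolynomial.aeval v p = ((MvPolynomial.aeval (fun i => (⟨v i, hv i⟩ : k)) p : k) : K) := by
      have := MvPolynomial.map_aeval (R := ℤ) (fun i => (⟨v i, hv i⟩ : k)) k.subtype p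
      change _ = k.subtype _
      rw [this, MvPolynomial.aeval_eq_eval₂Hom]
      exact congrArg (fun f => MvPolynomial.eval₂Hom f v p) (RingHom.ext_int _ _)
    rw [this]; exact Subtype.property _
  simp only [h3, and_true, Theory.model_singleton_iff, realize_allClosure, Formula.realize_imp, realize_polyMemU, realize_polyEqZero]
  have h4 : ∀ (v : Fin 2 → K),
      MvPolynomial.aeval v (MvPolynomial.X 0 : MvPolynomial (Fin 2) ℤ) ∈ k →
        MvPolynomial.aeval v (MvPolynomial.X 0 * MvPolynomial.X 1 - 1: MvPolynomial (Fin 2) ℤ) = 0 → MvPolynomial.aeval v (MvPolynomial.X 1: MvPolynomial (Fin 2) ℤ) ∈ k := by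
    intro v
    simp only [MvPolynomial.aeval_X, map_sub, map_mul, map_one]
    intro h h'
    have : v 1 = (v 0)⁻¹ := by
      refine (inv_eq_of_mul_eq_one_right ?_).symm
      linear_combination h'
    rw [this]; exact inv_mem h
  have h6 : (K ⊨ (allClosure (n := 1) (polyMemU (MvPolynomial.X 0))).not) ↔ k ≠ ⊤ := by
    rw [Sentence.realize_not, realize_allClosure]
    simp only [realize_polyMemU, MvPolynomial.aeval_X]
    rw [not_iff_not]
    constructor
    · intro h; ext x; simpa using h ![x]
    · rintro rfl; simp
  rw [h6]
  rw [and_assoc, and_assoc]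
  refine and_congr_right fun _ => (and_iff_right h4).trans (and_congr_left fun _ => ?_)
  rw [Theory.model_iff]
  constructor
  · intro h
    refine IsAlgClosed.of_exists_root _ ?_
    intro p hpm hpi
    have := h _ ⟨p.natDegree, Polynomial.natDegree_pos_iff_degree_pos.2
        (Polynomial.degree_pos_of_irreducible hpi), rfl⟩
    rw [realize_allClosure] at this
    have := this (fun i => (p.coeff i : K))
    simp only [Formula.realize_imp, realize_varsMemU, Formula.realize_iExs, Formula.realize_inf, realize_polyMemU, realize_polyEqZero] at this
    obtain ⟨y, hy, hy'⟩ := this (fun j => Subtype.property _)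
    simp at hy hy'
    refine ⟨⟨y 0, hy⟩, Subtype.ext ?_⟩
    rw [Polynomial.eval_eq_sum_range, Finset.sum_range_succ, Polynomial.Monic.coeff_natDegree hpm,
      Finset.sum_range]
    push_cast
    rw [← hy']; ring
  · rintro h _ ⟨n, hn, rfl⟩
    rw [realize_allClosure]
    intro v
    simp only [Formula.realize_imp, realize_varsMemU, Formula.realize_iExs, Formula.realize_inf, realize_polyMemU, realize_polyEqZero]
    intro hv
    let p : Polynomial k := Polynomial.X ^ n + ∑ i : Fin n, Polynomial.C (⟨v i, hv i⟩ : k) * Polynomial.X ^ (i : ℕ)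
    have hd : p.degree = n := by
      rw [Polynomial.degree_add_eq_left_of_degree_lt, Polynomial.degree_X_pow]
      rw [Polynomial.degree_X_pow]
      exact Polynomial.degree_sum_fin_lt _
    obtain ⟨y, hy⟩ := IsAlgClosed.exists_root p (by rw [hd]; exact_mod_cast hn.ne')
    refine ⟨fun _ => y, by simp, ?_⟩
    have := congrArg (Subtype.val) hy
    simpa [p, Polynomial.eval_finsetSum] using this

/-- Every model of `twoACF` is of the form `(K, k)`. -/
theorem exists_pair (M : Type u) [str : LU.Structure M] (h : M ⊨ twoACF) :
    ∃ (_ : Field M) (k : Subfield M), str = pairStructure M k := by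
  letI : FirstOrder.Language.ring.Structure M := (LHom.sumInl : FirstOrder.Language.ring →ᴸ LU).reduct M
  haveI : (LHom.sumInl : FirstOrder.Language.ring →ᴸ LU).IsExpansionOn M := LHom.isExpansionOn_reduct _ _
  have hU := h
  simp only [twoACF, Theory.model_union_iff] at h
  obtain ⟨⟨⟨⟨⟨h1, h2⟩, h3⟩, h4⟩, h5⟩, h6⟩ := h
  haveI : Theory.field.Model M := (LHom.onTheory_model (M := M) LHom.sumInl _).1 h1
  letI := Field.fieldOfModelField M
  letI := Field.compatibleRingOfModelField M
  have hp : ∀ {α : Type} (p : MvPolynomial α ℤ) (v : α → M), (polyTerm p).realize v = MvPolynomial.aeval v p := by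
    intro α p v
    refine (LHom.realize_onTerm (M := M) (LHom.sumInl) _ v).trans ?_
    rw [Ring.realize_termOfFreeCommRing]
    have : (FreeCommRing.lift v).comp (MvPolynomial.aeval FreeCommRing.of : MvPolynomial α ℤ →ₐ[ℤ] FreeCommRing α).toRingHom
     = (MvPolynomial.aeval v : MvPolynomial α ℤ →ₐ[ℤ] M).toRingHom := by
      apply MvPolynomial.ringHom_ext
      · intro r; simp
      · intro i; simp
    exact congrArg (fun f => f p) this
  let U : Set M := {x | Structure.RelMap (newRel FirstOrder.Language.ring 1) ![x]}
  have hm : ∀ {α : Type} (p : MvPolynomial α ℤ) (v : α → M), (polyMemU p).Realize v ↔ MvPolynomial.aeval v p ∈ U := by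
    intro α p v
    rw [polyMemU, Formula.realize_rel, ← hp]
    change _ ↔ Structure.RelMap _ _
    rw [iff_iff_eq]; congr 1; ext i; fin_cases i; rfl
  have hv : ∀ {α : Type} {m : ℕ} (x : Fin m → α) (v : α → M), (varsMemU x).Realize v ↔ ∀ j, v (x j) ∈ U := by
    intro α m x v
    simp [varsMemU, Formula.realize_iInf, hm]
  have h3' : ∀ (n : ℕ) (p : MvPolynomial (Fin n) ℤ) (v : Fin n → M), (∀ j, v j ∈ U) → MvPolynomial.aeval v p ∈ U := by
    intro n p v
    have := (Theory.model_iff _).1 h3 _ ⟨n, p, rfl⟩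
    rw [realize_allClosure] at this
    simpa [Formula.realize_imp, hv, hm] using this v
  have h4' : ∀ x ∈ U, ∀ y, x * y = 1 → y ∈ U := by
    intro x hx y hxy
    rw [Theory.model_singleton_iff, realize_allClosure] at h4
    have := h4 ![x, y]
    simp only [Formula.realize_imp, hm, polyEqZero, Formula.realize_equal, hp] at this
    simpa [hx, hxy] using this
  refine ⟨inferInstance,
    { carrier := U
      mul_mem' := fun {x y} hx hy => by simpa using h3' 2 (.X 0 * .X 1) ![x, y] (by simp [Fin.forall_fin_two, hx, hy])
      add_mem' := fun {x y} hx hy => by simpa using h3' 2 (.X 0 + .X 1) ![x, y] (by simp [Fin.forall_fin_two, hx, hy])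
      neg_mem' := fun {x} hx => by simpa using h3' 1 (- .X 0) ![x] (by simp [hx])
      one_mem' := by simpa using h3' 0 1 ![] (by simp)
      zero_mem' := by simpa using h3' 0 0 ![] (by simp)
      inv_mem' := fun x hx => by
        by_cases h0 : x = 0
        · subst h0; simpa using hx
        · exact h4' x hx _ (mul_inv_cancel₀ h0) }, ?_⟩
  apply Structure.ext
  · ext n f x
    rcases f with f | f
    · have : ∀ x, @Structure.funMap LU M str n (Sum.inl f) x = Structure.funMap f x := fun x => rfl
      rw [this]
      cases f
      · exact Ring.CompatibleRing.funMap_add x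
      · exact Ring.CompatibleRing.funMap_mul x
      · exact Ring.CompatibleRing.funMap_neg x
      · exact Ring.CompatibleRing.funMap_zero x
      · exact Ring.CompatibleRing.funMap_one x
    · exact nomatch f
  · ext n r x
    rcases r with r | r
    · exact nomatch r
    · cases r
      have key : ∀ x : Fin 1 → M, Structure.RelMap (newRel FirstOrder.Language.ring 1) x ↔ x 0 ∈ U := by
        intro x
        have : x = ![x 0] := by ext i; fin_cases i; rfl
        conv_lhs => rw [this]
        rfl
      exact key x
end

end

end PairACF

/-!
In a pair `(K, k)` the `Φ₂`-image of `A` is the set of elements algebraic over `k(A)`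
(`image_Phi2`): clear denominators and write the coefficients of a polynomial over `k[A]` as integer
polynomials in finitely many elements of `k` and of `A`. This is the closure operation of the
matroid of algebraic independence over `k`, hence a pregeometry.

No pair is a finite union of `Φ₂`-sets, because the elements of a `Φ₂`-set have bounded degree over
a field `k(A)` with `A` finite, while the degrees of all elements of `K` over `k(A)` are unbounded
(`not_bounded_degree`): a transcendental element `t` of a transcendence basis has roots of
arbitrarily large prime order.

A set `S ⊆ K` has dimension zero iff it is nonempty and contained in a finite union of `Φ₂`-sets
(`FormulaFamily.dim_eq_zero_iff`). One direction is a transfer to the saturated extension; the other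
one realizes the type of an element of `S` outside of all `Φ₂`-sets over `K`, and needs the
existence of a saturated elementary extension. That is obtained inside an ultrapower of the structure modulo
an ultrafilter on the valuations of a well-founded set of names (`Witness.exists_correct`), the
named elements forming the extension.

Uniform definability rests on the fact that any two elements of `K` outside of the `Φ₂`-image of a
tuple `v` have the same type over `v` (`realize_iff_realize_of_notMem_image`): both are
transcendental over `k(v)`, so an automorphism of `K` fixing `k` and `v` moves one to the other.
Hence `ψ(v, K)` or its complement is contained in the `Φ₂`-image of `v`, and by compactness finitely
many formulas `φ_P` suffice to cover one of the two, for all pairs and all `v`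
(`exists_finset_cover`). As `K` is not a finite union of `Φ₂`-sets, `ψ(v, K)` has dimension zero
iff it is nonempty and covered by these finitely many sets, which is a first-order condition on `v`.
-/

namespace PairACF

open FirstOrder.Language Cardinal

noncomputable section

/-! ### Existence of saturated elementary extensions -/

/-- Names for the elements of a saturated elementary extension of `M`: a name for each element
of `M`, and for each set of formulas in one variable, whose parameters are given by a family of
names indexed by `M`, a name for an element that realizes it if possible. -/
inductive Witness (L : FirstOrder.Language.{0, 0}) (M : Type u) : Type u
  | base : M → Witness L M
  | real : Set (L.Formula (M ⊕ Unit)) → (M → Witness L M) → Witness L M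

namespace Witness

open Filter

variable {L : FirstOrder.Language.{0, 0}} {M : Type u}

/-- Ultrafilters with the same trace on `D` agree on properties of valuations that depend only
on their values on `D`. -/
theorem eventually_iff_of_map_restrict_eq {D : Set (Witness L M)}
    {U U' : Ultrafilter (Witness L M → M)} (h : U.map D.domRestrict = U'.map D.domRestrict)
    {p : (Witness L M → M) → Prop} (hp : ∀ v v', (∀ c ∈ D, v c = v' c) → p v → p v') :
    (∀ᶠ v in (U : Filter (Witness L M → M)), p v) ↔
      ∀ᶠ v in (U' : Filter (Witness L M → M)), p v := by
  have key : {v | p v} = D.domRestrict ⁻¹' (D.domRestrict '' {v | p v}) := by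
    refine (Set.subset_preimage_image _ _).antisymm ?_
    rintro v ⟨v', hv', hvv'⟩
    exact hp v' v (fun c hc => congrFun hvv' ⟨c, hc⟩) hv'
  change {v | p v} ∈ U ↔ {v | p v} ∈ U'
  rw [key, ← Ultrafilter.mem_map, ← Ultrafilter.mem_map, h]

theorem map_restrict_eq_of_subset {D D' : Set (Witness L M)} (h : D ⊆ D')
    {U U' : Ultrafilter (Witness L M → M)} (hU : U.map D'.domRestrict = U'.map D'.domRestrict) :
    U.map D.domRestrict = U'.map D.domRestrict := by
  have : (D.domRestrict : (Witness L M → M) → _) = Set.domRestrict₂ h ∘ D'.domRestrict := rfl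
  rw [this, ← Ultrafilter.map_map, hU, Ultrafilter.map_map]

variable [L.Structure M]

/-- An ultrafilter `U` on the valuations of the names in `M` interprets the name `c` as intended:
elements of `M` name themselves, and the name attached to a set of formulas realizes that set if it
is finitely satisfiable (in the ultrapower of `M` modulo `U`). -/
def Correct (U : Ultrafilter (Witness L M → M)) : Witness L M → Prop
  | base m => ∀ᶠ v in (U : Filter (Witness L M → M)), v (base m) = m
  | real Γ f =>
    (∀ F : Finset (L.Formula (M ⊕ Unit)), ↑F ⊆ Γ → ∀ᶠ v in (U : Filter (Witness L M → M)),
      ∃ x, ∀ φ ∈ F, φ.Realize (Sum.elim (v ∘ f) fun _ => x)) →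
    ∀ φ ∈ Γ, ∀ᶠ v in (U : Filter (Witness L M → M)),
      φ.Realize (Sum.elim (v ∘ f) fun _ => v (real Γ f))

/-- A set of names containing with each name the names of its parameters. -/
def Closed (D : Set (Witness L M)) : Prop :=
  ∀ Γ f, real Γ f ∈ D → ∀ m, f m ∈ D

theorem Correct.congr {D : Set (Witness L M)} (hD : Closed D)
    {U U' : Ultrafilter (Witness L M → M)} (h : U.map D.domRestrict = U'.map D.domRestrict)
    {c : Witness L M} (hc : c ∈ D) (hU : Correct U c) : Correct U' c := by
  cases c with
  | base m =>
    refine (eventually_iff_of_map_restrict_eq h ?_).1 hU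
    intro v v' hv hvm
    rw [← hv _ hc, hvm]
  | real Γ f =>
    have hf : ∀ v v' : Witness L M → M, (∀ c ∈ D, v c = v' c) → v ∘ f = v' ∘ f :=
      fun v v' hv => funext fun m => hv _ (hD Γ f hc m)
    intro hF φ hφ
    refine (eventually_iff_of_map_restrict_eq h ?_).1 (hU (fun F hFΓ => ?_) φ hφ)
    · intro v v' hv
      rw [hf v v' hv, hv _ hc]
      exact id
    · refine (eventually_iff_of_map_restrict_eq h ?_).2 (hF F hFΓ)
      intro v v' hv
      rw [hf v v' hv]
      exact id

variable (L M) in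
/-- A partial construction of an ultrafilter that is correct for all names: an ultrafilter that is
correct for the names in a closed set `D`; only its trace on `D` matters. -/
structure Partial where
  /-- the set of names that have been treated -/
  D : Set (Witness L M)
  closed : Closed D
  U : Ultrafilter (Witness L M → M)
  correct : ∀ c ∈ D, Correct U c

/-- `q` extends `p`. -/
def Partial.Le (p q : Partial L M) : Prop :=
  p.D ⊆ q.D ∧ q.U.map p.D.domRestrict = p.U.map p.D.domRestrict

/-- The filter generated by the sets in the ultrafilter that depend only on the treated names. -/
def Partial.trace (p : Partial L M) : Filter (Witness L M → M) :=
  comap p.D.domRestrict (map p.D.domRestrict (p.U : Filter (Witness L M → M)))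

theorem Partial.neBot_trace (p : Partial L M) : p.trace.NeBot :=
  p.U.neBot.mono (by unfold trace; exact le_comap_map)

theorem Partial.map_eq_of_le_trace {p : Partial L M} {U : Ultrafilter (Witness L M → M)}
    (h : (U : Filter (Witness L M → M)) ≤ p.trace) :
    U.map p.D.domRestrict = p.U.map p.D.domRestrict := by
  apply Ultrafilter.coe_le_coe.1
  rw [Ultrafilter.coe_map, Ultrafilter.coe_map]
  exact map_le_iff_le_comap.2 h

theorem Partial.Le.trans {p q r : Partial L M} (h : p.Le q) (h' : q.Le r) : p.Le r :=
  ⟨h.1.trans h'.1, (map_restrict_eq_of_subset h.1 h'.2).trans h.2⟩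

theorem Partial.Le.trace_le {p q : Partial L M} (h : p.Le q) : q.trace ≤ p.trace := by
  have : (p.D.domRestrict : (Witness L M → M) → _) = Set.domRestrict₂ h.1 ∘ q.D.domRestrict := rfl
  have h2 := congrArg (fun V : Ultrafilter _ => (V : Filter (p.D → M))) h.2
  simp only [Ultrafilter.coe_map] at h2
  unfold trace
  rw [← h2, this, ← comap_comap, ← map_map]
  exact comap_mono le_comap_map

/-- Chains of partial constructions are bounded: any ultrafilter refining all their traces will
do. -/
theorem Partial.exists_upper_bound [Nonempty M] (C : Set (Partial L M)) (hC : IsChain Le C) :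
    ∃ q : Partial L M, ∀ p ∈ C, p.Le q := by
  rcases C.eq_empty_or_nonempty with rfl | hne
  · exact ⟨⟨∅, fun _ _ h => h.elim, Ultrafilter.of ⊤, fun _ h => h.elim⟩, fun _ h => h.elim⟩
  have : Nonempty C := hne.to_subtype
  have hdir : Directed (· ≥ ·) fun p : C => p.1.trace := by
    intro p q
    by_cases hpq : p = q
    · exact ⟨p, le_rfl, hpq ▸ le_rfl⟩
    rcases hC p.2 q.2 (fun h => hpq (Subtype.ext h)) with h | h
    · exact ⟨q, h.trace_le, le_rfl⟩
    · exact ⟨p, le_rfl, h.trace_le⟩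
  have hbot : (⨅ p : C, p.1.trace).NeBot :=
    iInf_neBot_of_directed hdir fun p => p.1.neBot_trace
  have hU : ∀ p ∈ C, (Ultrafilter.of (⨅ p : C, p.1.trace)).map p.D.domRestrict =
      p.U.map p.D.domRestrict := fun p hp =>
    Partial.map_eq_of_le_trace
      ((Ultrafilter.of_le _).trans (iInf_le (fun p : C => p.1.trace) ⟨p, hp⟩))
  refine ⟨⟨⋃ p ∈ C, p.D, ?_, Ultrafilter.of (⨅ p : C, p.1.trace), ?_⟩, fun p hp => ⟨?_, hU p hp⟩⟩
  · intro Γ f h m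
    simp only [Set.mem_iUnion] at h ⊢
    obtain ⟨p, hp, hf⟩ := h
    exact ⟨p, hp, p.closed Γ f hf m⟩
  · intro c hc
    simp only [Set.mem_iUnion] at hc
    obtain ⟨p, hp, hc⟩ := hc
    exact (p.correct c hc).congr p.closed (hU p hp).symm hc
  · exact Set.subset_biUnion_of_mem (u := fun p : Partial L M => p.D) hp

/-- A partial construction extends to one more name `c`, if an ultrafilter compatible with it is
correct for `c`. -/
theorem Partial.exists_extension (p : Partial L M) {c : Witness L M}
    (hc : Closed (insert c p.D)) {U : Ultrafilter (Witness L M → M)}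
    (hU : (U : Filter (Witness L M → M)) ≤ p.trace) (hUc : Correct U c) :
    ∃ q : Partial L M, p.Le q ∧ c ∈ q.D := by
  refine ⟨⟨insert c p.D, hc, U, ?_⟩,
    ⟨Set.subset_insert _ _, Partial.map_eq_of_le_trace hU⟩, Set.mem_insert _ _⟩
  rintro b (rfl | hb)
  · exact hUc
  · exact (p.correct b hb).congr p.closed (Partial.map_eq_of_le_trace hU).symm hb

open Classical in
/-- The trace does not restrict the values at names that have not been treated. -/
theorem Partial.exists_mem_update (p : Partial L M) {c : Witness L M} (hc : c ∉ p.D)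
    {s : Set (Witness L M → M)} (hs : s ∈ p.trace) {q : (Witness L M → M) → Prop}
    (hq : ∀ᶠ v in (p.U : Filter (Witness L M → M)), q v) :
    ∃ v, q v ∧ ∀ x : M, Function.update v c x ∈ s := by
  obtain ⟨t, ht, hts⟩ := hs
  obtain ⟨v, hv, hvt⟩ := (hq.and (mem_map.1 ht)).exists
  refine ⟨v, hv, fun x => hts ?_⟩
  have : p.D.domRestrict (Function.update v c x) = p.D.domRestrict v := by
    ext ⟨b, hb⟩
    exact Function.update_of_ne (by rintro rfl; exact hc hb) _ _
  rw [Set.mem_preimage, this]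
  exact hvt

variable (L M) in
/-- There is an ultrafilter that is correct for all names. A maximal partial construction treats
every name: given a finitely satisfiable set of formulas whose parameters have been treated, its
name is still free, so the set can be realized there without changing the trace. -/
theorem exists_correct [Nonempty M] :
    ∃ U : Ultrafilter (Witness L M → M), ∀ c, Correct U c := by
  classical
  obtain ⟨p, hp⟩ := exists_maximal_of_chains_bounded
    (r := Partial.Le (L := L) (M := M)) Partial.exists_upper_bound Partial.Le.trans
  refine ⟨p.U, fun c => p.correct c ?_⟩
  have hmax : ∀ c, (∃ q : Partial L M, p.Le q ∧ c ∈ q.D) → c ∈ p.D := fun c ⟨q, hq, hcq⟩ =>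
    (hp q hq).1 hcq
  induction c with
  | base m =>
    by_contra hc
    have : (p.trace ⊓ 𝓟 {v | v (base m) = m}).NeBot := by
      rw [inf_principal_neBot_iff]
      intro s hs
      obtain ⟨v, -, hv⟩ := p.exists_mem_update hc hs (q := fun _ => True) (by simp)
      exact ⟨_, hv m, by simp⟩
    have hle := Ultrafilter.of_le (p.trace ⊓ 𝓟 {v | v (base m) = m})
    refine hc (hmax _ (p.exists_extension ?_ (hle.trans inf_le_left) ?_))
    · rintro Γ f (h | h) k
      · cases h
      · exact Or.inr (p.closed Γ f h k)
    · exact hle.trans inf_le_right (mem_principal_self _)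
  | real Γ f ih =>
    by_contra hc
    have hcl : Closed (insert (real Γ f) p.D) := by
      rintro Δ g (h | h) k
      · cases h
        exact Or.inr (ih k)
      · exact Or.inr (p.closed Δ g h k)
    by_cases hfin : ∀ F : Finset (L.Formula (M ⊕ Unit)), ↑F ⊆ Γ →
        ∀ᶠ v in (p.U : Filter (Witness L M → M)),
          ∃ x, ∀ φ ∈ F, φ.Realize (Sum.elim (v ∘ f) fun _ => x)
    · let B : {F : Finset (L.Formula (M ⊕ Unit)) // ↑F ⊆ Γ} → Set (Witness L M → M) := fun F =>
        {v | ∀ φ ∈ F.1, φ.Realize (Sum.elim (v ∘ f) fun _ => v (real Γ f))}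
      have : Nonempty {F : Finset (L.Formula (M ⊕ Unit)) // ↑F ⊆ Γ} := ⟨⟨∅, by simp⟩⟩
      have hbot : (⨅ F, (p.trace ⊓ 𝓟 (B F))).NeBot := by
        refine iInf_neBot_of_directed ?_ ?_
        · intro F G
          refine ⟨⟨F.1 ∪ G.1, by simpa using ⟨F.2, G.2⟩⟩, ?_, ?_⟩ <;>
            refine inf_le_inf le_rfl (principal_mono.2 fun v hv φ hφ => hv φ ?_)
          · exact Finset.mem_union_left _ hφ
          · exact Finset.mem_union_right _ hφ
        · intro F
          rw [inf_principal_neBot_iff]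
          intro s hs
          obtain ⟨v, ⟨x, hx⟩, hv⟩ := p.exists_mem_update hc hs (hfin F.1 F.2)
          refine ⟨_, hv x, fun φ hφ => ?_⟩
          have hvf : Function.update v (real Γ f) x ∘ f = v ∘ f :=
            funext fun k => Function.update_of_ne (fun h : f k = real Γ f => hc (h ▸ ih k)) _ _
          rw [hvf, Function.update_self]
          exact hx φ hφ
      have hle := Ultrafilter.of_le (⨅ F, (p.trace ⊓ 𝓟 (B F)))
      refine hc (hmax _ (p.exists_extension hcl
        (hle.trans ((iInf_le _ ⟨∅, by simp⟩).trans inf_le_left)) fun _ φ hφ => ?_))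
      have hF : ↑({φ} : Finset (L.Formula (M ⊕ Unit))) ⊆ Γ := by simpa using hφ
      have hmem : B ⟨{φ}, hF⟩ ∈ Ultrafilter.of (⨅ F, (p.trace ⊓ 𝓟 (B F))) :=
        (hle.trans ((iInf_le _ ⟨{φ}, hF⟩).trans inf_le_right)) (mem_principal_self _)
      filter_upwards [hmem] with v hv using hv φ (by simp)
    · have hle : (p.U : Filter (Witness L M → M)) ≤ p.trace := le_comap_map
      exact hc (hmax _ (p.exists_extension hcl hle fun h => (hfin h).elim))

variable [Nonempty M] (U : Ultrafilter (Witness L M → M))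

/-- The element of the ultrapower named by `c`. -/
def eval (c : Witness L M) : (U : Filter (Witness L M → M)).Product fun _ => M :=
  Quotient.mk _ fun v : Witness L M → M => v c

theorem realize_eval {β : Type*} (φ : L.Formula β) (g : β → Witness L M) :
    φ.Realize (fun i => eval U (g i)) ↔
      ∀ᶠ v in (U : Filter (Witness L M → M)), φ.Realize (v ∘ g) :=
  Ultraproduct.realize_formula_cast (M := fun _ => M) (u := U) φ fun i v => v (g i)

/-- If a set of formulas with named parameters is finitely satisfiable in the ultrapower, then it is
realized by the element attached to it. -/
theorem Correct.realize_eval {U : Ultrafilter (Witness L M → M)}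
    {Γ : Set (L.Formula (M ⊕ Unit))} {f : M → Witness L M} (hU : Correct U (real Γ f))
    (h : ∀ F : Finset (L.Formula (M ⊕ Unit)), ↑F ⊆ Γ →
      ∃ x : (U : Filter (Witness L M → M)).Product fun _ => M,
        ∀ φ ∈ F, φ.Realize (Sum.elim (fun m => eval U (f m)) fun _ => x))
    {φ : L.Formula (M ⊕ Unit)} (hφ : φ ∈ Γ) :
    φ.Realize (Sum.elim (fun m => eval U (f m)) fun _ => eval U (real Γ f)) := by
  have := hU (fun F hF => ?_) φ hφ
  · have h2 := (Witness.realize_eval U φ (Sum.elim f fun _ => real Γ f)).2 (by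
      filter_upwards [this] with v hv
      rw [Sum.comp_elim]
      exact hv)
    have e : (Sum.elim (fun m => eval U (f m)) fun _ : Unit => eval U (real Γ f)) =
        fun i => eval U (Sum.elim f (fun _ => real Γ f) i) := by
      ext i
      rcases i with i | i <;> rfl
    rw [e]
    exact h2
  · obtain ⟨x, hx⟩ := h F hF
    obtain ⟨w, rfl⟩ := Quotient.exists_rep x
    have h1 : ∀ φ ∈ F, ∀ᶠ v in (U : Filter (Witness L M → M)),
        φ.Realize (Sum.elim (v ∘ f) fun _ => w v) := by
      intro φ hφ
      have h2 := (Ultraproduct.realize_formula_cast (M := fun _ => M) (u := U) φ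
        (Sum.elim (fun m v => v (f m)) fun _ => w)).1 (by
          refine (iff_of_eq (congrArg φ.Realize (funext ?_))).1 (hx φ hφ)
          rintro (i | i) <;> rfl)
      filter_upwards [h2] with v hv
      convert hv using 1
      ext (i | i) <;> rfl
    filter_upwards [(Filter.eventually_all_finset F).2 h1] with v hv using ⟨w v, hv⟩

variable {U}

/-- The witness property used in the Tarski–Vaught test: a formula with named parameters that is
satisfiable is satisfied by a named element. -/
theorem exists_eval_realize [Infinite M] (hU : ∀ c, Correct U c) {β : Type} [Finite β]
    (φ : L.Formula (β ⊕ Unit)) (t : β → Witness L M)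
    (h : ∃ x : (U : Filter (Witness L M → M)).Product fun _ => M,
      φ.Realize (Sum.elim (fun i => eval U (t i)) fun _ => x)) :
    ∃ c, φ.Realize (Sum.elim (fun i => eval U (t i)) fun _ => eval U c) := by
  obtain ⟨n, ⟨e⟩⟩ := Finite.exists_equiv_fin β
  let g : β ↪ M := e.toEmbedding.trans (Fin.valEmbedding.trans (Infinite.natEmbedding M))
  obtain ⟨m₀⟩ := ‹Nonempty M›
  let f : M → Witness L M := Function.extend g t (fun _ => base m₀)
  have hf : ∀ i, f (g i) = t i := fun i => g.injective.extend_apply _ _ _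
  let ψ : L.Formula (M ⊕ Unit) := φ.relabel (Sum.map g id)
  have hψ : ∀ x, ψ.Realize (Sum.elim (fun m => eval U (f m)) fun _ => x) ↔
      φ.Realize (Sum.elim (fun i => eval U (t i)) fun _ => x) := by
    intro x
    rw [Formula.realize_relabel, Sum.elim_comp_map]
    simp only [Function.comp_def, hf]
  refine ⟨real {ψ} f, (hψ _).1 ((hU _).realize_eval (fun F hF => ?_) rfl)⟩
  obtain ⟨x, hx⟩ := h
  refine ⟨x, fun φ hφ => ?_⟩
  rw [Set.mem_singleton_iff.1 (hF hφ)]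
  exact (hψ x).2 hx

/-- The elements of the ultrapower that have a name. -/
def named [Infinite M] (hU : ∀ c, Correct U c) :
    L.ElementarySubstructure ((U : Filter (Witness L M → M)).Product fun _ => M) :=
  Substructure.toElementarySubstructure
    { carrier := Set.range (eval U)
      fun_mem := by
        intro n f x hx
        choose t ht using hx
        let φ : L.Formula (Fin n ⊕ Unit) :=
          Term.equal (Term.func f fun i => Term.var (Sum.inl i)) (Term.var (Sum.inr ()))
        have hφ : ∀ y, φ.Realize (Sum.elim (fun i => eval U (t i)) fun _ => y) ↔
            Structure.funMap f x = y := by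
          intro y
          rw [Formula.realize_equal]
          simp only [Term.realize, Sum.elim_inl, Sum.elim_inr, ht]
        obtain ⟨c, hc⟩ := exists_eval_realize hU φ t ⟨_, (hφ _).2 rfl⟩
        exact ⟨c, ((hφ _).1 hc).symm⟩ }
    (by
      intro n φ x a h
      choose t ht using fun i => (x i).2
      let ψ : L.Formula (Fin n ⊕ Unit) := φ.toFormula.relabel
        (Sum.elim Empty.elim (Fin.lastCases (Sum.inr ()) Sum.inl))
      have hψ : ∀ y, ψ.Realize (Sum.elim (fun i => eval U (t i)) fun _ => y) ↔
          φ.Realize default (Fin.snoc (Subtype.val ∘ x) y : _ → _) := by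
        intro y
        rw [Formula.realize_relabel, BoundedFormula.realize_toFormula]
        apply iff_of_eq
        congr 1
        · exact Subsingleton.elim _ _
        · ext i
          refine Fin.lastCases ?_ (fun i => ?_) i
          · simp
          · simp [ht]
      obtain ⟨c, hc⟩ := exists_eval_realize hU ψ t ⟨a, (hψ a).2 h⟩
      exact ⟨⟨eval U c, c, rfl⟩, (hψ _).1 hc⟩)

theorem mem_named [Infinite M] {hU : ∀ c, Correct U c}
    {x : (U : Filter (Witness L M → M)).Product fun _ => M} :
    x ∈ named hU ↔ ∃ c, eval U c = x := Iff.rfl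

theorem realize_named [Infinite M] {hU : ∀ c, Correct U c} {β : Type*} (φ : L.Formula β)
    (v : β → named hU) : φ.Realize v ↔ φ.Realize fun i => (v i).1 :=
  ((named hU).subtype.map_formula φ v).symm

/-- The elementary embedding of `M` into the structure of the named elements. -/
def embedding [Infinite M] (hU : ∀ c, Correct U c) : M ↪ₑ[L] named hU where
  toFun m := ⟨eval U (base m), _, rfl⟩
  map_formula' n φ x := by
    rw [realize_named]
    refine (realize_eval U φ fun i => base (x i)).trans ?_
    have : ∀ᶠ v in (U : Filter (Witness L M → M)), ∀ i, v (base (x i)) = x i :=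
      Filter.eventually_all.2 fun i => hU (base (x i))
    rw [← Filter.eventually_const (f := (U : Filter (Witness L M → M))) (p := φ.Realize x)]
    refine Filter.eventually_congr ?_
    filter_upwards [this] with v hv
    rw [show (v ∘ fun i => base (x i)) = x from funext hv]

theorem isSaturated_named [Infinite M] (hU : ∀ c, Correct U c) :
    IsSaturated L (named hU) (Order.succ #M) := by
  intro A hA p hp
  classical
  obtain ⟨g⟩ : Nonempty (A ↪ M) := by
    rw [← Cardinal.le_def]
    exact Order.lt_succ_iff.1 hA
  choose t ht using fun a : A => mem_named.1 a.1.2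
  obtain ⟨m₀⟩ := ‹Nonempty M›
  -- the parameters in `A`, indexed by elements of `M`; the other indices are not used
  let f : M → Witness L M := Function.extend g t (fun _ => base m₀)
  have hf : ∀ a, eval U (f (g a)) = a.1.1 := fun a => by
    rw [← ht, show f (g a) = t a from g.injective.extend_apply _ _ _]
  let T : L[[A]].Formula (Fin 1) → L.Formula (M ⊕ Unit) := fun φ =>
    Formula.relabel (Sum.map g fun _ => ()) (BoundedFormula.constantsVarsEquiv φ)
  have hT : ∀ (φ : L[[A]].Formula (Fin 1)) (b : named hU),
      (T φ).Realize (Sum.elim (fun m => eval U (f m)) fun _ => b.1) ↔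
        φ.Realize fun _ => b := by
    intro φ b
    rw [Formula.realize_relabel, Sum.elim_comp_map]
    simp only [Function.comp_def, hf]
    rw [Formula.Realize, Formula.Realize, ← BoundedFormula.realize_constantsVarsEquiv]
    have e : (Sum.elim (fun a : A => a.1.1) fun _ : Fin 1 => b.1) =
        fun i => (Sum.elim (fun a : A => a.1) (fun _ => b) i).1 := by
      ext i
      rcases i with i | i <;> rfl
    have h := realize_named (L := L) (BoundedFormula.constantsVarsEquiv φ : L.Formula (A ⊕ Fin 1))
      (Sum.elim (fun a : A => a.1) fun _ => b)
    rw [← e, Formula.Realize, Formula.Realize] at h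
    refine Iff.trans ?_ h.symm
    rw [Unique.eq_default (default : Fin 0 → _)]
  refine ⟨⟨eval U (real (T '' p) f), _, rfl⟩, fun φ hφ => (hT φ _).1
    ((hU _).realize_eval (fun F hF => ?_) (Set.mem_image_of_mem T hφ))⟩
  obtain ⟨G, hG, rfl⟩ := Finset.subset_set_image_iff.1 hF
  obtain ⟨b, hb⟩ := hp G hG
  refine ⟨b.1, fun ψ hψ => ?_⟩
  obtain ⟨φ, hφ, rfl⟩ := Finset.mem_image.1 hψ
  exact (hT φ b).2 (hb φ hφ)

end Witness

/-- Every infinite structure has an elementary extension that is saturated in a cardinal greater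
than its size. -/
theorem exists_isSaturated_elementaryExtension (L : FirstOrder.Language.{0, 0}) (M : Type u)
    [L.Structure M] [Infinite M] :
    ∃ (N : Type u) (_ : L.Structure N), Nonempty (M ↪ₑ[L] N) ∧
      IsSaturated L N (Order.succ #M) := by
  obtain ⟨U, hU⟩ := Witness.exists_correct L M
  exact ⟨Witness.named hU, inferInstance, ⟨Witness.embedding hU⟩, Witness.isSaturated_named hU⟩

/-- Every structure for `L` with a new relation symbol is the expansion of an `L`-structure by
a set. -/
theorem exists_eq_expand (L : FirstOrder.Language.{0, 0}) {N : Type u} {n : ℕ}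
    (str : (addRel L n).Structure N) :
    ∃ (_ : L.Structure N) (T : Set (Fin n → N)), str = expand L T := by
  refine ⟨(LHom.sumInl : L →ᴸ addRel L n).reduct N, {x | Structure.RelMap (newRel L n) x}, ?_⟩
  apply Structure.ext
  · ext k f x
    rcases f with f | f
    · rfl
    · exact nomatch f
  · ext k r x
    rcases r with r | r
    · rfl
    · cases r
      rfl

instance nonempty_saturatedExtension (L : FirstOrder.Language.{0, 0}) {M : Type u}
    [L.Structure M] [Infinite M] {n : ℕ} (S : Set (Fin n → M)) :
    Nonempty (SaturatedExtension L S) := by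
  letI := expand L S
  obtain ⟨N, str, ⟨e⟩, hN⟩ := exists_isSaturated_elementaryExtension (addRel L n) M
  obtain ⟨strL, T, rfl⟩ := exists_eq_expand L str
  exact ⟨⟨N, T, e, Order.succ #M, (Cardinal.aleph0_le_mk M).trans (Order.le_succ _),
    Order.lt_succ _, hN⟩⟩

/-! ### Algebraic closure over a subfield -/

section Fields

variable {K : Type u} [Field K]

open IntermediateField.algebraAdjoinAdjoin in
theorem isAlgebraic_adjoin_iff_algebraAdjoin {k : Type u} [Field k] [Algebra k K] (A : Set K)
    (b : K) : IsAlgebraic (IntermediateField.adjoin k A) b ↔ IsAlgebraic (Algebra.adjoin k A) b :=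
  (IsFractionRing.isAlgebraic_iff (Algebra.adjoin k A) (IntermediateField.adjoin k A) K).symm

/-- The elements of `K` that are algebraic over `k(A)` form the closure of `A` in the matroid of
algebraic independence over `k`. -/
theorem setOf_isAlgebraic_adjoin_eq_closure (k : Subfield K) (A : Set K) :
    {b | IsAlgebraic (IntermediateField.adjoin k A) b} =
      (AlgebraicIndependent.matroid k K).closure A := by
  rw [AlgebraicIndependent.matroid_closure_eq]
  ext b
  exact isAlgebraic_adjoin_iff_algebraAdjoin A b

theorem isPregeometry_isAlgebraic_adjoin (k : Subfield K) :
    IsPregeometry fun A : Set K => {b | IsAlgebraic (IntermediateField.adjoin k A) b} := by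
  simp only [setOf_isAlgebraic_adjoin_eq_closure]
  exact
    { subset_cl := fun A => Matroid.subset_closure _ A
      mono := fun A B h => Matroid.closure_subset_closure _ h
      cl_cl := fun A => Matroid.closure_closure _ A
      finitary := fun A b hb => by
        obtain ⟨F, hFA, hF, -, hbF⟩ := Matroid.exists_mem_finite_closure_of_mem_closure hb
        exact ⟨F, hF, hFA, hbF⟩
      exchange := fun A a b h h' => Matroid.mem_closure_insert h' h }

/-- Any two elements of an algebraically closed field that are transcendental over `F` are conjugate
over `F`: both belong to transcendence bases, which have the same size. -/
theorem exists_algEquiv_of_transcendental [IsAlgClosed K] {F : Type*} [Field F] [Algebra F K]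
    {a b : K} (ha : Transcendental F a) (hb : Transcendental F b) :
    ∃ σ : K ≃ₐ[F] K, σ a = b := by
  classical
  have key : ∀ c : K, Transcendental F c →
      ∃ t : Set K, c ∈ t ∧ IsTranscendenceBasis F ((↑) : t → K) := by
    intro c hc
    have : AlgebraicIndepOn F id ({c} : Set K) :=
      (algebraicIndependent_singleton_iff (x := fun i : ({c} : Set K) => (i : K)) ⟨c, rfl⟩).2 hc
    obtain ⟨t, ht, hb⟩ := exists_isTranscendenceBasis_superset this
    exact ⟨t, ht rfl, hb⟩
  obtain ⟨s, has, hs⟩ := key a ha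
  obtain ⟨t, hbt, ht⟩ := key b hb
  obtain ⟨e₀⟩ := Cardinal.eq.1 (hs.cardinalMk_eq ht)
  -- adjust the bijection of the bases so that it maps `a` to `b`
  let e : s ≃ t := e₀.trans (Equiv.swap (e₀ ⟨a, has⟩) ⟨b, hbt⟩)
  have he : e ⟨a, has⟩ = ⟨b, hbt⟩ := by simp [e]
  letI := IsAlgClosed.isAlgClosure_of_transcendence_basis _ hs
  letI := IsAlgClosed.isAlgClosure_of_transcendence_basis _ ht
  let r : Algebra.adjoin F (Set.range ((↑) : s → K)) ≃ₐ[F]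
      Algebra.adjoin F (Set.range ((↑) : t → K)) :=
    (hs.1.aevalEquiv.symm.trans (MvPolynomial.renameEquiv F e)).trans ht.1.aevalEquiv
  let σ := IsAlgClosure.equivOfEquiv K K r.toRingEquiv
  have hσ : ∀ x, σ (algebraMap _ K x) = algebraMap _ K (r x) := fun x =>
    IsAlgClosure.equivOfEquiv_algebraMap K K r.toRingEquiv x
  refine ⟨AlgEquiv.ofRingEquiv (f := σ) fun x => ?_, ?_⟩
  · have := hσ (algebraMap F _ x)
    rwa [r.commutes, ← IsScalarTower.algebraMap_apply, ← IsScalarTower.algebraMap_apply] at this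
  · have h1 := hs.1.algebraMap_aevalEquiv (MvPolynomial.X ⟨a, has⟩)
    have h2 := ht.1.algebraMap_aevalEquiv (MvPolynomial.X ⟨b, hbt⟩)
    rw [MvPolynomial.aeval_X] at h1 h2
    have := hσ (hs.1.aevalEquiv (MvPolynomial.X ⟨a, has⟩))
    have hr : r (hs.1.aevalEquiv (MvPolynomial.X ⟨a, has⟩)) =
        ht.1.aevalEquiv (MvPolynomial.X ⟨b, hbt⟩) := by
      simp [r, he]
    rw [hr, h1, h2] at this
    exact this

/-- A polynomial over a domain `R ⊆ K` is a polynomial over `K` with coefficients in `R`. -/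
theorem exists_polynomial_iff_exists_coeff_mem_range {R : Type*} [CommRing R] [Algebra R K]
    (hR : Function.Injective (algebraMap R K)) (D : ℕ) (b : K) :
    (∃ p : Polynomial R, p ≠ 0 ∧ p.natDegree ≤ D ∧ Polynomial.aeval b p = 0) ↔
      ∃ p : Polynomial K, p ≠ 0 ∧ p.natDegree ≤ D ∧ p.eval b = 0 ∧
        ∀ i, p.coeff i ∈ Set.range (algebraMap R K) := by
  constructor
  · rintro ⟨p, hp, hD, hb⟩
    refine ⟨p.map (algebraMap R K), (Polynomial.map_ne_zero_iff hR).2 hp,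
      Polynomial.natDegree_map_le.trans hD, ?_, fun i => ?_⟩
    · rwa [Polynomial.eval_map_algebraMap]
    · rw [Polynomial.coeff_map]
      exact ⟨_, rfl⟩
  · rintro ⟨p, hp, hD, hb, hc⟩
    obtain ⟨q, rfl⟩ := (Polynomial.mem_lifts _).1 ((Polynomial.lifts_iff_coeff_lifts p).2 hc)
    refine ⟨q, (Polynomial.map_ne_zero_iff hR).1 hp, ?_, ?_⟩
    · rwa [Polynomial.natDegree_map_eq_of_injective hR] at hD
    · rwa [Polynomial.eval_map_algebraMap] at hb

theorem isAlgebraic_iff_exists_coeff_mem_range {R : Type*} [CommRing R] [Algebra R K]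
    (hR : Function.Injective (algebraMap R K)) (b : K) :
    IsAlgebraic R b ↔ ∃ p : Polynomial K, p ≠ 0 ∧ p.eval b = 0 ∧
      ∀ i, p.coeff i ∈ Set.range (algebraMap R K) := by
  constructor
  · rintro ⟨p, hp, hb⟩
    obtain ⟨q, hq, -, h⟩ :=
      (exists_polynomial_iff_exists_coeff_mem_range hR p.natDegree b).1 ⟨p, hp, le_rfl, hb⟩
    exact ⟨q, hq, h⟩
  · rintro ⟨p, hp, h⟩
    obtain ⟨q, hq, -, hb⟩ :=
      (exists_polynomial_iff_exists_coeff_mem_range hR p.natDegree b).2 ⟨p, hp, le_rfl, h⟩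
    exact ⟨q, hq, hb⟩

/-- A transcendental element generates a field in which it has no roots of prime order. -/
theorem pow_ne_gen_of_transcendental {F : Type*} [Field F] [Algebra F K] {t : K}
    (ht : Transcendental F t) {l : ℕ} (hl : l.Prime) (c : IntermediateField.adjoin F {t}) :
    c ^ l ≠ IntermediateField.AdjoinSimple.gen F t := by
  intro h
  let e := RatFunc.algEquivOfTranscendental t ht
  obtain ⟨d, rfl⟩ := e.surjective c
  have hX : e RatFunc.X = IntermediateField.AdjoinSimple.gen F t :=
    Subtype.ext (RatFunc.algEquivOfTranscendental_X t ht)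
  rw [← hX, ← map_pow] at h
  have hd : d ^ l = RatFunc.X := e.injective h
  have hd0 : d ≠ 0 := by
    rintro rfl
    rw [zero_pow hl.ne_zero] at hd
    exact RatFunc.X_ne_zero hd.symm
  -- compare degrees in `d ^ l = X`
  have hpow : ∀ n : ℕ, (d ^ n).intDegree = n * d.intDegree := by
    intro n
    induction n with
    | zero => simp
    | succ n ih =>
      rw [pow_succ, RatFunc.intDegree_mul (pow_ne_zero _ hd0) hd0, ih]
      push_cast
      ring
  have h1 := hpow l
  rw [hd, RatFunc.intDegree_X] at h1
  have : (l : ℤ) ∣ 1 := ⟨_, h1⟩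
  exact hl.one_lt.ne' (by exact_mod_cast Int.eq_one_of_dvd_one (by positivity) this)

/-- An element of degree at most `D` over a finite extension `L` of `E` has degree at most
`[L : E] * D` over `E`. -/
theorem finrank_adjoin_simple_le {E : Type*} [Field E] [Algebra E K] (L : Type*) [Field L]
    [Algebra E L] [Algebra L K] [IsScalarTower E L K] [FiniteDimensional E L] {b : K} {D : ℕ}
    {p : Polynomial L} (hp : p ≠ 0) (hpD : p.natDegree ≤ D)
    (hpb : Polynomial.aeval b p = 0) :
    Module.finrank E (IntermediateField.adjoin E {b}) ≤ Module.finrank E L * D := by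
  have hbL : IsIntegral L b := IsAlgebraic.isIntegral ⟨p, hp, hpb⟩
  let N := IntermediateField.adjoin L {b}
  have hN : Module.finrank L N ≤ D := by
    rw [IntermediateField.adjoin.finrank hbL]
    exact (Polynomial.natDegree_le_of_dvd (minpoly.dvd L b hpb) hp).trans hpD
  have : FiniteDimensional L N := IntermediateField.adjoin.finiteDimensional hbL
  have hEN : Module.finrank E N ≤ Module.finrank E L * D := by
    rw [← Module.finrank_mul_finrank E L N]
    exact Nat.mul_le_mul_left _ hN
  have : FiniteDimensional E N := FiniteDimensional.trans E L N
  have hle : IntermediateField.adjoin E {b} ≤ N.restrictScalars E := by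
    rw [IntermediateField.adjoin_simple_le_iff]
    exact IntermediateField.mem_adjoin_simple_self L b
  have : FiniteDimensional E (N.restrictScalars E) := ‹FiniteDimensional E N›
  exact (IntermediateField.finrank_le_of_le_right hle).trans hEN

/-- If a subset `A` of an algebraic extension `K` of `E` is finite, and the degrees of the elements
of `K` over a subfield `F` of `E(A)` are bounded, then so are their degrees over `E`. -/
theorem exists_finrank_adjoin_simple_le {E : Type*} [Field E] [Algebra E K] {A : Set K}
    (hA : A.Finite) (halg : ∀ b : K, IsAlgebraic E b) {D : ℕ} {F : Type*} [Field F] [Algebra F K]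
    (hF : ∀ x : F, algebraMap F K x ∈ IntermediateField.adjoin E A)
    (H : ∀ b : K, ∃ p : Polynomial F, p ≠ 0 ∧ p.natDegree ≤ D ∧ Polynomial.aeval b p = 0) :
    ∃ B, ∀ b : K, Module.finrank E (IntermediateField.adjoin E {b}) ≤ B := by
  have : Finite A := hA
  have hfin : FiniteDimensional E (IntermediateField.adjoin E A) :=
    IntermediateField.finiteDimensional_adjoin fun x _ => (halg x).isIntegral
  refine ⟨Module.finrank E (IntermediateField.adjoin E A) * D, fun b => ?_⟩
  obtain ⟨p, hp, hpD, hpb⟩ : ∃ p : Polynomial (IntermediateField.adjoin E A), p ≠ 0 ∧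
      p.natDegree ≤ D ∧ Polynomial.aeval b p = 0 := by
    refine (exists_polynomial_iff_exists_coeff_mem_range 
      (algebraMap (IntermediateField.adjoin E A) K).injective D b).2 ?_
    obtain ⟨p, hp, hpD, hpb, hc⟩ :=
      (exists_polynomial_iff_exists_coeff_mem_range (algebraMap F K).injective D b).1 (H b)
    refine ⟨p, hp, hpD, hpb, fun i => ?_⟩
    obtain ⟨x, hx⟩ := hc i
    exact ⟨⟨_, hF x⟩, hx⟩
  exact finrank_adjoin_simple_le _ hp hpD hpb

/-- The degrees of the elements of an algebraically closed field over a subfield `F(t)`, with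
`t` transcendental over `F`, are unbounded: `t` has roots of all prime orders. -/
theorem exists_lt_finrank_adjoin_simple [IsAlgClosed K] {F : Type*} [Field F] [Algebra F K] {t : K}
    (ht : Transcendental F t) (B : ℕ) :
    ∃ b : K, B < Module.finrank (IntermediateField.adjoin F {t})
      (IntermediateField.adjoin (IntermediateField.adjoin F {t}) {b}) := by
  obtain ⟨l, hlB, hl⟩ := Nat.exists_infinite_primes (B + 1)
  obtain ⟨b, hb⟩ := IsAlgClosed.exists_pow_nat_eq t hl.pos
  have hirr := X_pow_sub_C_irreducible_of_prime hl (pow_ne_gen_of_transcendental ht hl)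
  have hmon := Polynomial.monic_X_pow_sub_C (IntermediateField.AdjoinSimple.gen F t) hl.ne_zero
  have hroot : Polynomial.aeval b (Polynomial.X ^ l -
      Polynomial.C (IntermediateField.AdjoinSimple.gen F t)) = 0 := by
    simp only [map_sub, map_pow, Polynomial.aeval_X, Polynomial.aeval_C, hb]
    exact sub_eq_zero.2 rfl
  refine ⟨b, ?_⟩
  rw [IntermediateField.adjoin.finrank ⟨_, hmon, hroot⟩,
    ← minpoly.eq_of_irreducible_of_monic hirr hroot hmon, Polynomial.natDegree_X_pow_sub_C]
  exact hlB

/-- In an algebraically closed proper extension `K` of an algebraically closed field `k`, the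
degrees of elements over a finitely generated subfield `k(A)` are unbounded. Indeed, if `K` is
algebraic over `k(A)`, an element `t` of a transcendence basis contained in `A` has roots of
arbitrarily large prime order, whereas it has no such roots in the field generated by that basis. -/
theorem not_bounded_degree [IsAlgClosed K] (k : Subfield K) [IsAlgClosed k] (hk : k ≠ ⊤)
    {A : Set K} (hA : A.Finite) (D : ℕ) :
    ¬ ∀ b : K, ∃ p : Polynomial (IntermediateField.adjoin k A),
      p ≠ 0 ∧ p.natDegree ≤ D ∧ Polynomial.aeval b p = 0 := by
  intro H
  have halg : Algebra.IsAlgebraic (Algebra.adjoin k A) K := ⟨fun b => by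
    obtain ⟨p, hp, -, hb⟩ := H b
    exact (isAlgebraic_adjoin_iff_algebraAdjoin A b).1 ⟨p, hp, hb⟩⟩
  obtain ⟨s, hsA, hs⟩ := exists_isTranscendenceBasis_subset (R := k) A
  have hne : s.Nonempty := by
    rw [Set.nonempty_iff_ne_empty]
    rintro rfl
    have : Algebra.IsAlgebraic k K := hs.isEmpty_iff_isAlgebraic.1 inferInstance
    refine hk (eq_top_iff.2 fun x _ => ?_)
    obtain ⟨y, rfl⟩ := (IsAlgClosed.algebraMap_bijective_of_isIntegral (k := k) (K := K)).2 x
    exact y.2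
  obtain ⟨t, hts⟩ := hne
  -- `E = k(s)`, viewed as a simple transcendental extension of `k₀`
  let k₀ := IntermediateField.adjoin k (s \ {t})
  have ht : Transcendental k₀ t := by
    intro h
    rw [isAlgebraic_adjoin_iff_algebraAdjoin] at h
    have := hs.1.transcendental_adjoin (s := {x | x.1 ≠ t}) (i := ⟨t, hts⟩) (by simp)
    refine this ?_
    have hst : ((↑) : s → K) '' {x | x.1 ≠ t} = s \ {t} := by
      ext x
      simp [and_comm]
    rw [hst]
    exact h
  let E := IntermediateField.adjoin k₀ {t}
  have hkE : ∀ x ∈ k, x ∈ E := fun x hx =>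
    E.algebraMap_mem (algebraMap k k₀ ⟨x, hx⟩)
  have hsE : ∀ x ∈ s, x ∈ E := by
    intro x hx
    by_cases hxt : x = t
    · subst hxt
      exact IntermediateField.mem_adjoin_simple_self _ _
    · exact E.algebraMap_mem (⟨x, IntermediateField.subset_adjoin _ _ ⟨hx, hxt⟩⟩ : k₀)
  have hadjE : ∀ x ∈ Algebra.adjoin k s, x ∈ E := by
    intro x hx
    induction hx using Algebra.adjoin_induction with
    | mem x hx => exact hsE x hx
    | algebraMap x => exact hkE x x.2
    | add x y _ _ hx hy => exact E.add_mem hx hy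
    | mul x y _ _ hx hy => exact E.mul_mem hx hy
  have halgE : ∀ b : K, IsAlgebraic E b := by
    intro b
    have hb := hs.isAlgebraic.isAlgebraic b
    rw [Subtype.range_coe,
      isAlgebraic_iff_exists_coeff_mem_range Subtype.val_injective] at hb
    obtain ⟨p, hp, hpb, hc⟩ := hb
    refine (isAlgebraic_iff_exists_coeff_mem_range (algebraMap E K).injective b).2
      ⟨p, hp, hpb, fun i => ?_⟩
    obtain ⟨x, hx⟩ := hc i
    exact ⟨⟨_, hadjE x.1 x.2⟩, hx⟩
  have hAE : ∀ x ∈ IntermediateField.adjoin k A, x ∈ IntermediateField.adjoin E A := by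
    intro x hx
    induction hx using IntermediateField.adjoin_induction with
    | mem x hx => exact IntermediateField.subset_adjoin _ _ hx
    | algebraMap x =>
      exact IntermediateField.algebraMap_mem _ (⟨x, hkE x x.2⟩ : E)
    | add x y _ _ hx hy => exact add_mem hx hy
    | mul x y _ _ hx hy => exact mul_mem hx hy
    | inv x _ hx => exact inv_mem hx
  obtain ⟨B, hB⟩ := exists_finrank_adjoin_simple_le hA halgE (fun x => hAE x.1 x.2) H
  obtain ⟨b, hb⟩ := exists_lt_finrank_adjoin_simple ht B
  exact (hB b).not_gt hb

end Fields

/-! ### Sets of dimension zero -/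

section DimZero

variable {L : FirstOrder.Language.{0, 0}} (Φ : FormulaFamily L)

namespace FormulaFamily

/-- The rank of `A ∪ {b}` over `A` is zero iff `b` depends on `A`; that bases exist has to be
checked, since the infimum of the empty set is zero. -/
theorem rk_union_singleton_eq_zero_iff {N : Type u} [L.Structure N]
    (hN : IsPregeometry (Φ.image : Set N → Set N)) (A : Set N) (b : N) :
    Φ.rk (A ∪ {b}) A = 0 ↔ b ∈ Φ.image A := by
  have hb : b ∈ Φ.image (A ∪ {b}) := hN.subset_cl _ (Or.inr rfl)
  have hempty : b ∈ Φ.image A → Φ.IsBasisOver A (A ∪ {b}) ∅ := by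
    intro h
    refine ⟨Set.empty_subset _, fun x hx => hx.elim, ?_⟩
    rw [Set.union_empty]
    refine Set.Subset.antisymm ?_ (hN.mono _ _ Set.subset_union_left)
    have := hN.mono (A ∪ {b}) (Φ.image A)
      (Set.union_subset (hN.subset_cl A) (Set.singleton_subset_iff.2 h))
    rwa [hN.cl_cl] at this
  constructor
  · intro h
    have hne : {c | ∃ I : Set N, Φ.IsBasisOver A (A ∪ {b}) I ∧ c = #I}.Nonempty := by
      by_cases hA : b ∈ Φ.image A
      · exact ⟨_, ∅, hempty hA, rfl⟩
      · refine ⟨_, {b}, ⟨Set.singleton_subset_iff.2 hb, ?_, rfl⟩, rfl⟩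
        rintro x rfl
        simpa using hA
    obtain ⟨I, hI, h0⟩ := csInf_mem hne
    rw [rk] at h
    rw [h, eq_comm, Cardinal.mk_eq_zero_iff] at h0
    rw [hI.2.2, Set.isEmpty_coe_sort.1 h0, Set.union_empty] at hb
    exact hb
  · intro h
    refine le_antisymm (csInf_le' ⟨∅, hempty h, ?_⟩) zero_le
    simp

/-- The formula `φ_i(a, y)`, where `a` is a tuple of variables from `γ`. -/
def fiberFormula {γ : Type*} (g : Σ i, Fin (Φ.arity i) → γ) : L.Formula (γ ⊕ Fin 1) :=
  (Φ.formula g.1).relabel (Sum.map g.2 fun _ => 0)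

theorem realize_fiberFormula {γ : Type*} {N : Type u} [L.Structure N]
    (g : Σ i, Fin (Φ.arity i) → γ) (j : γ → N) (b : Fin 1 → N) :
    (Φ.fiberFormula g).Realize (Sum.elim j b) ↔ b 0 ∈ Φ.fiber g.1 (j ∘ g.2) := by
  rw [fiberFormula, Formula.realize_relabel, Sum.elim_comp_map]
  rfl

/-- `S` is contained in a finite union of `Φ`-sets. -/
def IsSmall {M : Type u} [L.Structure M] (S : Set (Fin 1 → M)) : Prop :=
  ∃ G : Finset (Σ i, Fin (Φ.arity i) → M), ∀ s ∈ S, ∃ g ∈ G, s 0 ∈ Φ.fiber g.1 g.2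

variable {M : Type u} [L.Structure M] {S : Set (Fin 1 → M)}

/-- A cover of `S` by `Φ`-sets also covers the extension of `S` to an elementary extension. -/
theorem IsSmall.mem_image (hS : Φ.IsSmall S) (E : SaturatedExtension L S) {s : Fin 1 → E.N}
    (hs : s ∈ E.T) :
    letI := E.str
    s 0 ∈ Φ.image (Set.range E.ι) := by
  letI := E.str
  letI := relStructure S
  letI := relStructure E.T
  letI := expand L S
  letI := expand L E.T
  obtain ⟨G, hG⟩ := hS
  -- the formula stating that the `Φ`-sets in `G` cover `S`
  let χ : (addRel L 1).Formula M := Formula.iAlls (Fin 1)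
    (((newRel L 1).formula fun i => Term.var (Sum.inr i)).imp
      (Formula.iSup fun g : G => (LHom.sumInl : L →ᴸ addRel L 1).onFormula (Φ.fiberFormula g.1)))
  have hM : χ.Realize (id : M → M) := by
    simp only [χ, Formula.realize_iAlls, Formula.realize_imp, Formula.realize_iSup,
      LHom.realize_onFormula, realize_fiberFormula]
    intro t ht
    obtain ⟨g, hg, htg⟩ := hG t ht
    exact ⟨⟨g, hg⟩, htg⟩
  have hN := (E.emb.map_formula χ id).2 hM
  simp only [χ, Formula.realize_iAlls, Formula.realize_imp, Formula.realize_iSup,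
    LHom.realize_onFormula, realize_fiberFormula] at hN
  obtain ⟨g, hg⟩ := hN s hs
  exact ⟨g.1.1, _, fun j => ⟨_, rfl⟩, hg⟩

/-- If `S` is not contained in a finite union of `Φ`-sets, then, by saturation, the extension of
`S` contains an element outside of the `Φ`-image of `M`. -/
theorem exists_notMem_image_of_not_isSmall (hS : ¬ Φ.IsSmall S) (E : SaturatedExtension L S) :
    letI := E.str
    ∃ s ∈ E.T, s 0 ∉ Φ.image (Set.range E.ι) := by
  letI := E.str
  letI := relStructure S
  letI := relStructure E.T
  letI := expand L S
  letI := expand L E.T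
  -- the type over `M` of an element of `S` outside of all `Φ`-sets over `M`
  let q : Option (Σ i, Fin (Φ.arity i) → M) → (addRel L 1).Formula (M ⊕ Fin 1) := fun o =>
    o.elim ((newRel L 1).formula fun i => Term.var (Sum.inr i))
      fun g => ((LHom.sumInl : L →ᴸ addRel L 1).onFormula (Φ.fiberFormula g)).not
  let A : Set E.N := Set.range E.ι
  let j : M → A := Set.rangeFactorization E.ι
  let P : Option (Σ i, Fin (Φ.arity i) → M) → (addRel L 1)[[A]].Formula (Fin 1) := fun o =>
    BoundedFormula.constantsVarsEquiv.symm (Formula.relabel (Sum.map j id) (q o))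
  have hP : ∀ o (b : Fin 1 → E.N), (P o).Realize b ↔ (q o).Realize (Sum.elim E.ι b) := by
    intro o b
    rw [Formula.Realize, ← BoundedFormula.realize_constantsVarsEquiv, Equiv.apply_symm_apply]
    refine (Formula.realize_relabel (φ := q o) (g := Sum.map j id)).trans ?_
    rw [Sum.elim_comp_map]
    rfl
  have hM : ∀ o (b : Fin 1 → M), (P o).Realize (E.ι ∘ b) ↔ (q o).Realize (Sum.elim id b) := by
    intro o b
    rw [hP, ← E.emb.map_formula (q o) (Sum.elim id b), Sum.comp_elim]
    rfl
  have hfin : ∀ F : Finset ((addRel L 1)[[A]].Formula (Fin 1)), ↑F ⊆ Set.range P →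
      ∃ b : E.N, ∀ φ ∈ F, φ.Realize fun _ => b := by
    classical
    intro F hF
    rw [← Set.image_univ] at hF
    obtain ⟨G, -, rfl⟩ := Finset.subset_set_image_iff.1 hF
    by_contra! hG
    refine hS ⟨G.eraseNone, fun s hs => ?_⟩
    by_contra! hsG
    obtain ⟨φ, hφ, hφs⟩ := hG (E.ι (s 0))
    obtain ⟨o, ho, rfl⟩ := Finset.mem_image.1 hφ
    refine hφs ((hM o fun _ => s 0).2 ?_)
    have hs0 : (fun _ => s 0) = s := funext fun i => congrArg s (Subsingleton.elim _ _)
    cases o with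
    | none =>
      rw [hs0]
      exact hs
    | some g =>
      change ¬ Formula.Realize _ _
      rw [LHom.realize_onFormula, realize_fiberFormula]
      exact hsG g (Finset.mem_eraseNone.2 ho)
  obtain ⟨b, hb⟩ := E.saturated A (Cardinal.mk_range_le.trans_lt E.card_lt) (Set.range P) hfin
  refine ⟨fun _ => b, (hP none _).1 (hb _ ⟨none, rfl⟩), ?_⟩
  rintro ⟨i, a, ha, hab⟩
  choose c hc using ha
  have := (hP (some ⟨i, c⟩) _).1 (hb _ ⟨some ⟨i, c⟩, rfl⟩)
  change ¬ Formula.Realize _ _ at this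
  rw [LHom.realize_onFormula, realize_fiberFormula] at this
  refine this ?_
  rw [show E.ι ∘ c = a from funext hc]
  exact hab

/-- If `(Φ, Γ)` defines a pregeometry, then a set has dimension zero in a model of `Γ` iff it is
nonempty and contained in a finite union of `Φ`-sets. -/
theorem dim_eq_zero_iff {Γ : L.Theory} (hΦ : DefinesPregeometry.{u} Φ Γ) [Infinite M]
    (hM : M ⊨ Γ) : Φ.dim S = 0 ↔ S.Nonempty ∧ Φ.IsSmall S := by
  have hpre : ∀ E : SaturatedExtension L S,
      letI := E.str
      IsPregeometry (Φ.image : Set E.N → Set E.N) := by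
    intro E
    letI := E.str
    letI := relStructure S
    letI := relStructure E.T
    letI := expand L S
    letI := expand L E.T
    have : Nonempty E.N := ‹Infinite M›.nonempty.map E.ι
    refine hΦ E.N ?_
    rw [← LHom.onTheory_model (LHom.sumInl : L →ᴸ addRel L 1), ← E.emb.theory_model_iff,
      LHom.onTheory_model]
    exact hM
  have hrk : ∀ (E : SaturatedExtension L S) (s : Fin 1 → E.N),
      letI := E.str
      Cardinal.toENat (Φ.rk (Set.range E.ι ∪ Set.range s) (Set.range E.ι)) = 0 ↔
        s 0 ∈ Φ.image (Set.range E.ι) := by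
    intro E s
    letI := E.str
    rw [Cardinal.toENat_eq_zero, Set.range_unique (f := s)]
    exact Φ.rk_union_singleton_eq_zero_iff (hpre E) _ _
  rw [dim]
  split_ifs with h
  · simp [h]
  · simp only [WithBot.coe_eq_zero, ← bot_eq_zero', iSup_eq_bot]
    simp only [bot_eq_zero', hrk]
    refine ⟨fun H => ⟨Set.nonempty_iff_ne_empty.2 h, ?_⟩, fun H E s hs => H.2.mem_image Φ E hs⟩
    by_contra hS
    obtain ⟨E⟩ : Nonempty (SaturatedExtension L S) := inferInstance
    obtain ⟨s, hs, hs'⟩ := Φ.exists_notMem_image_of_not_isSmall hS E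
    exact hs' (H E s hs)

end FormulaFamily

end DimZero

/-! ### The family `Φ₂` in pairs of algebraically closed fields -/

section Pairs

variable {K : Type u} [Field K] (k : Subfield K)

theorem aeval_mem_adjoin {m n : ℕ} {x : Fin m → K} (hx : ∀ j, x j ∈ k) (a : Fin n → K)
    (q : MvPolynomial (Fin m ⊕ Fin n) ℤ) :
    MvPolynomial.aeval (Sum.elim x a) q ∈ IntermediateField.adjoin k (Set.range a) := by
  induction q using MvPolynomial.induction_on with
  | C r => simp
  | add p q hp hq =>
    rw [map_add]
    exact add_mem hp hq
  | mul_X p i hp =>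
    rw [map_mul, MvPolynomial.aeval_X]
    refine mul_mem hp ?_
    rcases i with i | i
    · exact IntermediateField.algebraMap_mem _ (⟨x i, hx i⟩ : k)
    · exact IntermediateField.subset_adjoin _ _ ⟨i, rfl⟩

/-- The elements of a `Φ₂`-set are roots of polynomials of bounded degree over the field generated
by `k` and the parameters. -/
theorem exists_polynomial_of_mem_fiber {i : Phi2.Idx} {a : Fin (Phi2.arity i) → K} {b : K}
    (hb : letI := pairStructure K k
      b ∈ Phi2.fiber i a) :
    ∃ p : Polynomial K, p ≠ 0 ∧ p.natDegree ≤ i.2.2.natDegree ∧ p.eval b = 0 ∧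
      ∀ j, p.coeff j ∈ IntermediateField.adjoin k (Set.range a) := by
  obtain ⟨m, n, P⟩ := i
  obtain ⟨x, hx, hb, h0⟩ := (mem_fiber_Phi2 k m n P a b).1 hb
  refine ⟨_, h0, Polynomial.natDegree_map_le, hb, fun j => ?_⟩
  rw [Polynomial.coeff_map]
  exact aeval_mem_adjoin k hx a _

/-- An element of the ring generated by `k` and `A` is the value of an integer polynomial. -/
theorem exists_aeval_eq_of_mem_adjoin {A : Set K} {c : K} (hc : c ∈ Algebra.adjoin k A) :
    ∃ q : MvPolynomial (k ⊕ A) ℤ,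
      MvPolynomial.aeval (Sum.elim (fun y : k => (y : K)) fun y : A => (y : K)) q = c := by
  induction hc using Algebra.adjoin_induction with
  | mem x hx => exact ⟨MvPolynomial.X (Sum.inr ⟨x, hx⟩), by simp⟩
  | algebraMap x => exact ⟨MvPolynomial.X (Sum.inl x), by simp; rfl⟩
  | add x y _ _ hx hy =>
    obtain ⟨p, rfl⟩ := hx
    obtain ⟨q, rfl⟩ := hy
    exact ⟨p + q, map_add _ _ _⟩
  | mul x y _ _ hx hy =>
    obtain ⟨p, rfl⟩ := hx
    obtain ⟨q, rfl⟩ := hy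
    exact ⟨p * q, map_mul _ _ _⟩

/-- In a pair, the `Φ₂`-image of `A` consists of the elements algebraic over `k(A)`. -/
theorem image_Phi2 (A : Set K) :
    letI := pairStructure K k
    Phi2.image A = {b | IsAlgebraic (IntermediateField.adjoin k A) b} := by
  letI := pairStructure K k
  classical
  ext b
  constructor
  · rintro ⟨i, a, ha, hb⟩
    obtain ⟨p, hp, -, hpb, hc⟩ := exists_polynomial_of_mem_fiber k hb
    refine (isAlgebraic_iff_exists_coeff_mem_range
      (algebraMap (IntermediateField.adjoin k A) K).injective b).2
      ⟨p, hp, hpb, fun j => ⟨⟨_, ?_⟩, rfl⟩⟩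
    exact IntermediateField.adjoin.mono _ _ _ (Set.range_subset_iff.2 ha) (hc j)
  · intro hb
    obtain ⟨p, hp, hpb, hc⟩ := (isAlgebraic_iff_exists_coeff_mem_range Subtype.val_injective b).1
      ((isAlgebraic_adjoin_iff_algebraAdjoin A b).1 hb)
    have hc' : ∀ j, p.coeff j ∈ Algebra.adjoin k A := fun j => by
      obtain ⟨y, hy⟩ := hc j
      exact hy ▸ y.2
    choose q hq using fun j => exists_aeval_eq_of_mem_adjoin k (hc' j)
    -- the finitely many variables occurring in the coefficients, and an enumeration of them
    let V : Finset (k ⊕ A) := (Finset.range (p.natDegree + 1)).biUnion fun j => (q j).vars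
    let x : Fin V.toLeft.card → k := fun j => (V.toLeft.equivFin.symm j).1
    let a : Fin V.toRight.card → A := fun j => (V.toRight.equivFin.symm j).1
    have hinj : Function.Injective (Sum.map x a) :=
      Sum.map_injective.2 ⟨Subtype.val_injective.comp (Equiv.injective _),
        Subtype.val_injective.comp (Equiv.injective _)⟩
    have hV : (V : Set (k ⊕ A)) ⊆ Set.range (Sum.map x a) := by
      rintro (y | y) hy
      · refine ⟨Sum.inl (V.toLeft.equivFin ⟨y, Finset.mem_toLeft.2 hy⟩), ?_⟩
        simp [x]
      · refine ⟨Sum.inr (V.toRight.equivFin ⟨y, Finset.mem_toRight.2 hy⟩), ?_⟩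
        simp [a]
    have hcoeff : ∀ j, p.coeff j ∈ Set.range
        (MvPolynomial.aeval (Sum.elim (fun i => (x i : K)) fun i => (a i : K)) :
          MvPolynomial (Fin V.toLeft.card ⊕ Fin V.toRight.card) ℤ →ₐ[ℤ] K).toRingHom := by
      intro j
      by_cases hj : j ∈ Finset.range (p.natDegree + 1)
      · obtain ⟨r, hr⟩ := MvPolynomial.exists_rename_eq_of_vars_subset_range (q j) _ hinj
          ((Finset.coe_subset.2 (Finset.subset_biUnion_of_mem (fun j => (q j).vars) hj)).trans hV)
        refine ⟨r, ?_⟩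
        rw [← hq j, ← hr, MvPolynomial.aeval_rename, Sum.elim_comp_map]
        rfl
      · rw [Polynomial.coeff_eq_zero_of_natDegree_lt (by simpa [Nat.lt_succ_iff] using hj)]
        exact ⟨0, map_zero _⟩
    obtain ⟨P, hP⟩ := (Polynomial.mem_lifts _).1 ((Polynomial.lifts_iff_coeff_lifts p).2 hcoeff)
    refine ⟨⟨_, _, P⟩, fun i => a i, fun i => (a i).2, ?_⟩
    refine (mem_fiber_Phi2 k _ _ P _ b).2 ⟨fun i => x i, fun i => (x i).2,
      (congrArg (Polynomial.eval b) hP).trans hpb, fun h => hp (hP.symm.trans h)⟩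

variable {k}

/-- An automorphism of `K` mapping `k` onto itself is an automorphism of the pair. -/
def pairEquiv (σ : K ≃+* K) (hσ : ∀ x, σ x ∈ k ↔ x ∈ k) :
    letI := pairStructure K k
    K ≃[LU] K :=
  letI := Ring.compatibleRingOfRing K
  letI := relStructure {x : Fin 1 → K | x 0 ∈ k}
  letI := pairStructure K k
  { σ.toEquiv with
    map_fun' := by
      intro n f x
      rcases f with f | f
      · exact (Ring.languageEquivEquivRingEquiv.symm σ).map_fun f x
      · exact nomatch f
    map_rel' := by
      intro n r x
      rcases r with r | r
      · exact nomatch r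
      · cases r
        exact hσ _ }

/-- Any two elements outside of the `Φ₂`-image of a tuple have the same type over this tuple, since
they are conjugate under an automorphism of the pair that fixes the tuple and `k`. -/
theorem realize_iff_realize_of_notMem_image {M : Type u} [str : LU.Structure M] (hM : M ⊨ twoACF)
    {γ : Type*} (ψ : LU.Formula (γ ⊕ Fin 1)) (v : γ → M) {b b' : Fin 1 → M}
    (hb : b 0 ∉ Phi2.image (Set.range v)) (hb' : b' 0 ∉ Phi2.image (Set.range v)) :
    ψ.Realize (Sum.elim v b) ↔ ψ.Realize (Sum.elim v b') := by
  obtain ⟨_, k, rfl⟩ := exists_pair M hM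
  letI := pairStructure M k
  have := ((models_iff k).1 hM).1
  rw [image_Phi2] at hb hb'
  obtain ⟨σ, hσ⟩ := exists_algEquiv_of_transcendental hb hb'
  have hfix : ∀ x ∈ IntermediateField.adjoin k (Set.range v), σ x = x := fun x hx =>
    σ.commutes ⟨x, hx⟩
  have hk : ∀ x ∈ k, σ x = x := fun x hx =>
    hfix x (IntermediateField.algebraMap_mem _ (⟨x, hx⟩ : k))
  have hσk : ∀ x, σ.toRingEquiv x ∈ k ↔ x ∈ k := by
    intro x
    refine ⟨fun h => ?_, fun h => (hk x h).symm ▸ h⟩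
    have : σ (σ x) = σ x := hk _ h
    exact σ.injective this ▸ h
  rw [← StrongHomClass.realize_formula (pairEquiv σ.toRingEquiv hσk) ψ, Sum.comp_elim]
  apply iff_of_eq
  congr 2
  · ext i
    exact hfix _ (IntermediateField.subset_adjoin _ _ ⟨i, rfl⟩)
  · ext i
    rw [Subsingleton.elim i 0]
    exact hσ

end Pairs

theorem definesPregeometry_Phi2 : DefinesPregeometry.{u} Phi2 twoACF := by
  intro M _ _ hM
  obtain ⟨_, k, rfl⟩ := exists_pair M hM
  rw [funext (image_Phi2 k)]
  exact isPregeometry_isAlgebraic_adjoin k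

theorem isNontrivial_Phi2 : IsNontrivial.{u} Phi2 twoACF := by
  rintro M _ _ hM ⟨F, hF, hFΦ, hFM⟩
  obtain ⟨_, k, rfl⟩ := exists_pair M hM
  obtain ⟨_, _, hk⟩ := (models_iff k).1 hM
  have key : ∀ X ∈ F, ∃ (A : Set M) (D : ℕ), A.Finite ∧ ∀ b ∈ X, ∃ p : Polynomial M, p ≠ 0 ∧
      p.natDegree ≤ D ∧ p.eval b = 0 ∧ ∀ j, p.coeff j ∈ IntermediateField.adjoin k A := by
    intro X hX
    obtain ⟨i, a, rfl⟩ := hFΦ X hX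
    exact ⟨_, _, Set.finite_range a, fun b hb => exists_polynomial_of_mem_fiber k hb⟩
  choose! A D hA hp using key
  let B := ⋃ X ∈ F, A X
  refine not_bounded_degree k hk (A := B) (hF.biUnion hA) (hF.toFinset.sup D) fun b => ?_
  obtain ⟨X, hX, hbX⟩ : b ∈ ⋃₀ F := hFM ▸ Set.mem_univ b
  obtain ⟨p, hp, hpD, hpb, hc⟩ := hp X hX b hbX
  refine (exists_polynomial_iff_exists_coeff_mem_range
    (algebraMap (IntermediateField.adjoin k B) M).injective _ b).2
    ⟨p, hp, hpD.trans (Finset.le_sup (hF.mem_toFinset.2 hX)), hpb, fun j => ⟨⟨_, ?_⟩, rfl⟩⟩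
  exact IntermediateField.adjoin.mono _ _ _ (Set.subset_biUnion_of_mem hX) (hc j)

/-! ### Uniform definability of dimension zero -/

/-- In the language with constants `c` for the variables in `γ` and two further constants `d₀`,
`d₁`, the theory of pairs together with sentences stating that `d₀` satisfies `ψ(c, y)`, `d₁` does
not, and neither is in one of finitely many given `Φ₂`-sets with parameters from `c`. -/
def separationTheory {γ : Type*} (ψ : LU.Formula (γ ⊕ Fin 1))
    (G : Finset (Σ i, Fin (Phi2.arity i) → γ)) : LU[[γ ⊕ Fin 2]].Theory :=
  (LU.lhomWithConstants (γ ⊕ Fin 2)).onTheory twoACF ∪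
    ({Formula.equivSentence (ψ.relabel (Sum.map id fun _ => 0) ⊓
      (ψ.relabel (Sum.map id fun _ => 1)).not)} ∪
    {σ | ∃ g ∈ G, ∃ j : Fin 2, σ = Formula.equivSentence
      ((Phi2.fiberFormula g).relabel (Sum.map id fun _ => j)).not})

theorem model_separationTheory {γ : Type*} (ψ : LU.Formula (γ ⊕ Fin 1))
    (G : Finset (Σ i, Fin (Phi2.arity i) → γ)) {M : Type*} [LU.Structure M]
    [LU[[γ ⊕ Fin 2]].Structure M] [(LU.lhomWithConstants (γ ⊕ Fin 2)).IsExpansionOn M]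
    {v : γ → M} {d : Fin 2 → M} (hv : ∀ i, ((LU.con (Sum.inl i : γ ⊕ Fin 2) : _) : M) = v i)
    (hd : ∀ i, ((LU.con (Sum.inr i : γ ⊕ Fin 2) : _) : M) = d i) :
    M ⊨ separationTheory ψ G ↔ M ⊨ twoACF ∧
      (ψ.Realize (Sum.elim v fun _ => d 0) ∧ ¬ ψ.Realize (Sum.elim v fun _ => d 1)) ∧
      ∀ g ∈ G, ∀ j, d j ∉ Phi2.fiber g.1 (v ∘ g.2) := by
  have hrel : ∀ (χ : LU.Formula (γ ⊕ Fin 1)) (j : Fin 2),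
      (χ.relabel (Sum.map id fun _ => j)).Realize
        (fun i : γ ⊕ Fin 2 => ((LU.con i : _) : M)) ↔ χ.Realize (Sum.elim v fun _ => d j) := by
    intro χ j
    rw [Formula.realize_relabel]
    apply iff_of_eq
    congr 1
    ext (i | i)
    · exact hv i
    · exact hd j
  rw [separationTheory, Theory.model_union_iff, Theory.model_union_iff, LHom.onTheory_model,
    Theory.model_singleton_iff, Formula.realize_equivSentence, Formula.realize_inf,
    Formula.realize_not, hrel, hrel]
  refine and_congr_right fun _ => and_congr_right fun _ => ?_
  rw [Theory.model_iff]
  constructor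
  · intro h g hg j
    have := h _ ⟨g, hg, j, rfl⟩
    rw [Formula.realize_equivSentence, Formula.realize_not, hrel,
      FormulaFamily.realize_fiberFormula] at this
    exact this
  · rintro h _ ⟨g, hg, j, rfl⟩
    rw [Formula.realize_equivSentence, Formula.realize_not, hrel,
      FormulaFamily.realize_fiberFormula]
    exact h g hg j

/-- For each formula `ψ(x, y)` there are finitely many formulas in the family `Φ₂` such that, in
every pair and for every `v`, the `Φ₂`-sets given by these formulas and `v` cover `ψ(v, M)` or its
complement. Otherwise compactness yields a pair with elements `d₀`, `d₁` outside of the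
`Φ₂`-image of `v` that are separated by `ψ(v, y)`. -/
theorem exists_finset_cover {γ : Type*} (ψ : LU.Formula (γ ⊕ Fin 1)) :
    ∃ G : Finset (Σ i, Fin (Phi2.arity i) → γ),
      ∀ (M : Type u) [LU.Structure M] [Nonempty M], M ⊨ twoACF → ∀ v : γ → M,
        (∀ b : Fin 1 → M, ψ.Realize (Sum.elim v b) → ∃ g ∈ G, b 0 ∈ Phi2.fiber g.1 (v ∘ g.2)) ∨
        ∀ b : Fin 1 → M, ¬ ψ.Realize (Sum.elim v b) → ∃ g ∈ G, b 0 ∈ Phi2.fiber g.1 (v ∘ g.2) := by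
  classical
  by_contra! H
  have hconst : ∀ {M : Type u} (b : Fin 1 → M), (fun _ => b 0) = b := fun b =>
    funext fun i => congrArg b (Subsingleton.elim _ _)
  have hsat : ∀ G, (separationTheory ψ G).IsSatisfiable := by
    intro G
    obtain ⟨M, _, _, hM, v, ⟨b₀, h₀, hb₀⟩, b₁, h₁, hb₁⟩ := H G
    letI := constantsOn.structure (Sum.elim v ![b₀ 0, b₁ 0])
    have : M ⊨ separationTheory ψ G := by
      refine (model_separationTheory ψ G (v := v) (d := ![b₀ 0, b₁ 0])
        (fun i => rfl) (fun i => rfl)).2 ⟨hM, ⟨?_, ?_⟩, ?_⟩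
      · rw [Matrix.cons_val_zero, hconst]
        exact h₀
      · rw [Matrix.cons_val_one, Matrix.cons_val_zero, hconst]
        exact h₁
      · intro g hg j
        fin_cases j
        · exact hb₀ g hg
        · exact hb₁ g hg
    exact Theory.Model.isSatisfiable M
  have hdir : Directed (· ⊆ ·) (separationTheory ψ) := by
    intro G G'
    refine ⟨G ∪ G', ?_, ?_⟩ <;>
    · refine Set.union_subset_union_right _ (Set.union_subset_union_right _ ?_)
      rintro σ ⟨g, hg, h⟩
      exact ⟨g, by simp [hg], h⟩
  obtain ⟨N⟩ := (Theory.isSatisfiable_directed_union_iff hdir).2 hsat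
  letI : LU.Structure N := (LU.lhomWithConstants (γ ⊕ Fin 2)).reduct N
  haveI : (LU.lhomWithConstants (γ ⊕ Fin 2)).IsExpansionOn N := LHom.isExpansionOn_reduct _ _
  let v : γ → N := fun i => (LU.con (Sum.inl i : γ ⊕ Fin 2) : _)
  let d : Fin 2 → N := fun i => (LU.con (Sum.inr i : γ ⊕ Fin 2) : _)
  have hN : ∀ G, _ := fun G => (model_separationTheory ψ G (M := N) (v := v) (d := d)
    (fun i => rfl) (fun i => rfl)).1 (N.is_model.mono (Set.subset_iUnion _ G))
  have hd : ∀ j, d j ∉ Phi2.image (Set.range v) := by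
    rintro j ⟨i, a, ha, hda⟩
    choose t ht using ha
    refine (hN {⟨i, t⟩}).2.2 ⟨i, t⟩ (Finset.mem_singleton_self _) j ?_
    rw [show v ∘ t = a from funext ht]
    exact hda
  have := hN ∅
  exact this.2.1.2 ((realize_iff_realize_of_notMem_image this.1 ψ v (hd 0) (hd 1)).1 this.2.1.1)

theorem infinite_of_models_twoACF {M : Type u} [str : LU.Structure M] (hM : M ⊨ twoACF) :
    Infinite M := by
  obtain ⟨_, k, rfl⟩ := exists_pair M hM
  have := ((models_iff k).1 hM).1
  exact IsAlgClosed.instInfinite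

/-- In every pair, `ψ(v, M)` has dimension zero iff it is nonempty and covered by the `Φ₂`-sets
given by `exists_finset_cover`: a small set cannot have a small complement. -/
theorem exists_formula_realize_iff_dim_eq_zero {γ : Type*} (ψ : LU.Formula (γ ⊕ Fin 1)) :
    ∃ θ : LU.Formula γ, ∀ (M : Type u) [LU.Structure M] [Nonempty M], M ⊨ twoACF →
      ∀ v : γ → M, θ.Realize v ↔ Phi2.dim {b : Fin 1 → M | ψ.Realize (Sum.elim v b)} = 0 := by
  classical
  obtain ⟨G, hG⟩ := exists_finset_cover.{u} ψ
  refine ⟨Formula.iExs (Fin 1) ψ ⊓ Formula.iAlls (Fin 1)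
    (ψ.imp (Formula.iSup fun g : G => Phi2.fiberFormula g.1)), fun M _ _ hM v => ?_⟩
  have := infinite_of_models_twoACF hM
  rw [Phi2.dim_eq_zero_iff definesPregeometry_Phi2 hM]
  simp only [Formula.realize_inf, Formula.realize_iExs, Formula.realize_iAlls, Formula.realize_imp,
    Formula.realize_iSup, FormulaFamily.realize_fiberFormula]
  let toM : (Σ i, Fin (Phi2.arity i) → γ) → Σ i, Fin (Phi2.arity i) → M := fun g => ⟨g.1, v ∘ g.2⟩
  refine and_congr_right fun _ => ⟨fun h => ⟨G.image toM, fun s hs => ?_⟩, fun ⟨G', hG'⟩ => ?_⟩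
  · obtain ⟨g, hg⟩ := h s hs
    exact ⟨toM g.1, Finset.mem_image_of_mem _ g.2, hg⟩
  · rcases hG M hM v with h | h
    · intro b hb
      obtain ⟨g, hg, hbg⟩ := h b hb
      exact ⟨⟨g, hg⟩, hbg⟩
    · refine (isNontrivial_Phi2 M hM ⟨(fun g : Σ i, Fin (Phi2.arity i) → M => Phi2.fiber g.1 g.2) ''
        ((G.image toM ∪ G' : Finset _) : Set _), (Finset.finite_toSet _).image _, ?_, ?_⟩).elim
      · rintro _ ⟨g, -, rfl⟩
        exact ⟨g.1, g.2, rfl⟩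
      · refine Set.eq_univ_of_forall fun b => ?_
        by_cases hb : ψ.Realize (Sum.elim v fun _ => b)
        · obtain ⟨g, hg, hbg⟩ := hG' _ hb
          exact ⟨_, ⟨g, Finset.mem_coe.2 (Finset.mem_union_right _ hg), rfl⟩, hbg⟩
        · obtain ⟨g, hg, hbg⟩ := h _ hb
          exact ⟨_, ⟨toM g, Finset.mem_coe.2 (Finset.mem_union_left _
            (Finset.mem_image_of_mem _ hg)), rfl⟩, hbg⟩

/-- Splitting off the last variable of a formula. -/
theorem section_setOf_realize {M : Type u} [LU.Structure M] {γ : Type*} {n : ℕ}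
    (φ : LU.Formula (γ ⊕ Fin (n + 1))) (p : γ → M) (a : Fin n → M) :
    section_ {c : Fin (n + 1) → M | φ.Realize (Sum.elim p c)} a =
      {b : Fin 1 → M | (φ.relabel (Sum.elim (Sum.inl ∘ Sum.inl)
        (Fin.append (Sum.inl ∘ Sum.inr) Sum.inr)) :
          LU.Formula ((γ ⊕ Fin n) ⊕ Fin 1)).Realize (Sum.elim (Sum.elim p a) b)} := by
  ext b
  change φ.Realize _ ↔ Formula.Realize _ _
  rw [Formula.realize_relabel]
  apply iff_of_eq
  congr 1
  ext (i | i)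
  · rfl
  · refine Fin.addCases (fun i => ?_) (fun i => ?_) i <;> simp

theorem isBounded_Phi2 : IsBounded.{u} Phi2 twoACF := by
  refine ⟨isNontrivial_Phi2, fun M _ _ hM n S hS => ?_⟩
  obtain ⟨φ, rfl⟩ := Set.definable_iff_exists_formula_sum.1 hS
  obtain ⟨θ, hθ⟩ := exists_formula_realize_iff_dim_eq_zero.{u}
    (φ.relabel (Sum.elim (Sum.inl ∘ Sum.inl) (Fin.append (Sum.inl ∘ Sum.inr) Sum.inr)) :
      LU.Formula (((Set.univ : Set M) ⊕ Fin n) ⊕ Fin 1))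
  refine Set.definable_iff_exists_formula_sum.2 ⟨θ, Set.ext fun a => ?_⟩
  change _ ↔ θ.Realize _
  rw [hθ M hM, ← section_setOf_realize]
  rfl

end

end PairACF

theorem mainTheorem4 :
    -- In a pair `(K, k)`, the operation `A ↦ Φ₂(A)` is `A ↦ acl(k(A))`.
    (∀ (K : Type u) [Field K] [IsAlgClosed K] (k : Subfield K) [IsAlgClosed k], k ≠ ⊤ →
      letI := PairACF.pairStructure K k
      ∀ A : Set K, PairACF.Phi2.image A = {b | IsAlgebraic (IntermediateField.adjoin k A) b}) ∧
    -- `(Φ₂, 2ACF)` defines a pregeometry, and is bounded.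
    PairACF.DefinesPregeometry.{u} PairACF.Phi2 PairACF.twoACF ∧
    PairACF.IsBounded.{u} PairACF.Phi2 PairACF.twoACF ∧
    -- Uniformity: the defining formula depends only on the formula defining the family.
    (∀ (n : ℕ) (ψ : PairACF.LU.Formula (Fin (n + 1))), ∃ θ : PairACF.LU.Formula (Fin n),
      ∀ (M : Type u) [PairACF.LU.Structure M] [Nonempty M], M ⊨ PairACF.twoACF →
        ∀ a : Fin n → M, θ.Realize a ↔
          PairACF.Phi2.dim (PairACF.section_ {c : Fin (n + 1) → M | ψ.Realize c} a) = 0) := by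
  refine ⟨fun K _ _ k _ _ A => PairACF.image_Phi2 k A, PairACF.definesPregeometry_Phi2,
    PairACF.isBounded_Phi2, fun n ψ => ?_⟩
  obtain ⟨θ, hθ⟩ := PairACF.exists_formula_realize_iff_dim_eq_zero.{u}
    (ψ.relabel (Fin.append Sum.inl Sum.inr) : PairACF.LU.Formula (Fin n ⊕ Fin 1))
  refine ⟨θ, fun M _ _ hM a => ?_⟩
  have hsec : PairACF.section_ {c : Fin (n + 1) → M | ψ.Realize c} a = {b : Fin 1 → M |
      (ψ.relabel (Fin.append Sum.inl Sum.inr) : PairACF.LU.Formula (Fin n ⊕ Fin 1)).Realize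
        (Sum.elim a b)} := by
    ext b
    change ψ.Realize _ ↔ FirstOrder.Language.Formula.Realize _ _
    rw [FirstOrder.Language.Formula.realize_relabel]
    apply iff_of_eq
    congr 1
    ext i
    refine Fin.addCases (fun i => ?_) (fun i => ?_) i <;> simp
  rw [hθ M hM, hsec]
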